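/- Fix $d\in\mathbb N$, $m=(m_1,\dots,m_d)\in\mathbb N^d$, a field $k$, and an infinite extension field $K$ of $k$ (for example $K=k$ if $k$ is infinite, or $K=\bar k$ for arbitrary $k$). Affine spaces $K^\sigma$ carry the Zariski topology over $k$: closed sets are the sets of common zeros in $K^\sigma$ of polynomials with coefficients in $k$. **The grid.** Let $I=[1,m_1]\times\dots\times[1,m_d]$, and let $E\subset I\times I$ be the set of arrows $(i,j):i\to j$ such that $j$ is obtained from $i$ by raising exactly one coordinate by $1$. Let $A$ be the generalized Cartan matrix with $A_{ii}=2$ and $A_{ij}=-\#\{\text{arrows } i\to j\}-\#\{\text{arrows } j\to i\}$ for $i\ne j$. Let $(\mathfrak h,\{\alpha_i\},\{h_i\})$ be any realization of $A$: a complex vector space of dimension $2|I|-\operatorname{rank}A$ with linearly independent $\alpha_i\in\mathfrak h^*$ and linearly independent $h_i\in\mathfrak h$, $\langle h_i,\alpha_j\rangle=A_{ij}$. Let $P\subset\mathfrak h^*$ be any weight lattice: a free abelian subgroup containing all $\alpha_i$, with $\mathbb C\otimes_{\mathbb Z}P\cong\mathfrak h^*$ naturally and $\langle h_i,P\rangle\subset\mathbb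 Z$ for all $i$. **Components.** For $\nu=-\sum_i\nu_i\alpha_i$ with $\nu_i\in\mathbb N$, let $E_C(\nu)$ be the set of families $f=(f_\tau)_{\tau\in E}$ of linear maps $f_\tau:K^{\nu_{s(\tau)}}\to K^{\nu_{t(\tau)}}$ ($s,t$ denoting source and target) whose compositions along any two parallel paths agree, with the topology induced from the affine space of matrix entries. Let $B_C(\nu)$ be the set of irreducible components of $E_C(\nu)$ and $B_C=\bigsqcup_\nu B_C(\nu)$. For $\Lambda\in B_C(\nu)$ put $\mathrm{wt}(\Lambda)=\nu$, $$\varepsilon_i^*(f)=\dim\ker\Big((f_\tau)_{s(\tau)=i}:K^{\nu_i}\to\bigoplus_{s(\tau)=i}K^{\nu_{t(\tau)}}\Big),\quad \varepsilon_i^*(\Lambda)=\min_{f\in\Lambda}\varepsilon_i^*(f),\quad \varphi_i^*(\Lambda)=\varepsilon_i^*(\Lambda)+\langle h_i,\mathrm{wt}(\Lambda)\rangle .$$ **Operators.** For $i\in I$ and $\nu+\alpha_i\in-\sum_j\mathbb N\alpha_j$, let $E'_C(-\alpha_i,\nu+\alpha_i)$ be the set of triples $((\bar\phi_j)_{j\in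 I},(\phi'_j)_{j\in I},f)$ with $f\in E_C(\nu)$ and short exact sequences $0\to K^{\delta_{ij}}\xrightarrow{\bar\phi_j}K^{\nu_j}\xrightarrow{\phi'_j}K^{\nu_j-\delta_{ij}}\to0$ such that $f_\tau(\operatorname{im}\bar\phi_{s(\tau)})\subset\operatorname{im}\bar\phi_{t(\tau)}$ for all $\tau$. Let $\varpi_4$ send such a triple to $f\in E_C(\nu)$, and let $\varpi_3$ send it to the quotient representation $f'\in E_C(\nu+\alpha_i)$, determined by $f'_\tau\phi'_{s(\tau)}=\phi'_{t(\tau)}f_\tau$. Let $\mathrm{in}_1(i)=\{j:(j,i)\in E\}$, and let $\mathrm{in}_2(i)$ be the set of $l\in I$ that have arrows to two distinct elements of $\mathrm{in}_1(i)$. For $f\in E_C(\nu)$ let $F_i(f):\bigoplus_{j\in\mathrm{in}_1(i)}K^{\nu_j}\to\bigoplus_{l\in\mathrm{in}_2(i)}K^{\nu_l}$ have the component $f_{(l,j)}^{T}$ (respectively $-f_{(l,j)}^{T}$) from $j$ to $l$ if $l$ has arrows to $j$ and to some $j'\in\mathrm{in}_1(i)$ with $j<j'$ (respectively $j'<j$)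 lexicographically, and $0$ otherwise. Put $\widetilde{\mathrm{Ext}}{}^*_i(f)=(\ker F_i(f))^*$. For $\Lambda'\in B_C(\nu+\alpha_i)$ let $\Lambda'^{3}\subset\Lambda'$ be the locus where $\dim\widetilde{\mathrm{Ext}}{}^*_i$ attains its minimum on $\Lambda'$. For $\Lambda\in B_C(\nu)$ let $\Lambda^4\subset\Lambda$ be the locus where $\varepsilon_i^*$ attains its minimum on $\Lambda$. Define $$\tilde f_i^*\Lambda'=\begin{cases}\overline{\varpi_4\varpi_3^{-1}(\Lambda'^{3})}&\text{if this set lies in }B_C(\nu),\\0&\text{otherwise,}\end{cases}$$ $$\tilde e_i^*\Lambda=\begin{cases}\overline{\varpi_3\varpi_4^{-1}(\Lambda^{4})}&\text{if }\varepsilon_i^*(\Lambda)>0\text{ and this set lies in }B_C(\nu+\alpha_i),\\0&\text{otherwise.}\end{cases}$$ **Theorem.** The tuple $(B_C,\mathrm{wt},(\varepsilon_i^*)_{i\in I},(\varphi_i^*)_{i\in I},(\tilde e_i^*)_{i\in I},(\tilde f_i^*)_{i\in I})$ is a (Kashiwara) crystal for $A$ and $P$. That is, $A$ is a generalized Cartan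 matrix, $\mathrm{wt}$ takes values in $P$, $\varepsilon_i^*$ and $\varphi_i^*$ take values in $\mathbb Z\sqcup\{-\infty\}$, $\tilde e_i^*$ and $\tilde f_i^*$ take values in $B_C\sqcup\{0\}$, and for all $i\in I$ and $b,b'\in B_C$: 1. $\varphi_i^*(b)=\varepsilon_i^*(b)+\langle h_i,\mathrm{wt}(b)\rangle$; 2. if $\tilde e_i^*b\ne0$, then $\mathrm{wt}(\tilde e_i^*b)=\mathrm{wt}(b)+\alpha_i$, $\varepsilon_i^*(\tilde e_i^*b)=\varepsilon_i^*(b)-1$ and $\varphi_i^*(\tilde e_i^*b)=\varphi_i^*(b)+1$; 3. if $\tilde f_i^*b\ne0$, then $\mathrm{wt}(\tilde f_i^*b)=\mathrm{wt}(b)-\alpha_i$, $\varepsilon_i^*(\tilde f_i^*b)=\varepsilon_i^*(b)+1$ and $\varphi_i^*(\tilde f_i^*b)=\varphi_i^*(b)-1$; 4. $b=\tilde e_i^*b'$ if and only if $\tilde f_i^*b=b'$; 5. if $\varphi_i^*(b)=-\infty$, then $\tilde e_i^*b=\tilde f_i^*b=0$. -/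

import Mathlib

/-! # The star-crystal of irreducible components of varieties of persistence modules -/

noncomputable section

namespace PersistenceCrystal

/-! ## Kashiwara crystals -/

section Crystals

variable {I : Type*} [Fintype I]

/-- Generalized Cartan matrices. -/
structure IsGCM (A : Matrix I I ℤ) : Prop where
  diag : ∀ i, A i i = 2
  nonpos : ∀ i j, i ≠ j → A i j ≤ 0
  symm_ne_zero : ∀ i j, i ≠ j → A i j ≠ 0 → A j i ≠ 0

/-- A realization `(𝔥, Π, Π^∨)` of a square integral matrix `A`: linearly independent simple
roots `α_i ∈ 𝔥*` and simple coroots `h_i ∈ 𝔥` with `⟨h_i, α_j⟩ = A i j`, where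
`dim 𝔥 = 2 |I| - rank A`. -/
structure Realization (A : Matrix I I ℤ) (𝔥 : Type*) [AddCommGroup 𝔥] [Module ℂ 𝔥] where
  root : I → Module.Dual ℂ 𝔥
  coroot : I → 𝔥
  root_linearIndependent : LinearIndependent ℂ root
  coroot_linearIndependent : LinearIndependent ℂ coroot
  root_coroot : ∀ i j, root j (coroot i) = (A i j : ℂ)
  finiteDimensional : FiniteDimensional ℂ 𝔥
  finrank_add_rank :
    Module.finrank ℂ 𝔥 + (A.map (Int.cast : ℤ → ℂ)).rank = 2 * Fintype.card I

variable {A : Matrix I I ℤ} {𝔥 : Type*} [AddCommGroup 𝔥] [Module ℂ 𝔥]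

/-- A weight lattice for a realization: a free abelian subgroup `P ⊂ 𝔥*` with
`ℂ ⊗_ℤ P ≅ 𝔥*` (through the natural map), with `⟨h_i, λ⟩ ∈ ℤ` for `λ ∈ P`, and with
`α_i ∈ P`. -/
structure WeightLattice (R : Realization A 𝔥) where
  P : Submodule ℤ (Module.Dual ℂ 𝔥)
  free : Module.Free ℤ P
  isBaseChange : IsBaseChange ℂ P.subtype
  integral : ∀ (i : I) (v : Module.Dual ℂ 𝔥), v ∈ P → ∃ n : ℤ, v (R.coroot i) = (n : ℂ)
  root_mem : ∀ i, R.root i ∈ P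

namespace WeightLattice

variable {R : Realization A 𝔥} (L : WeightLattice R)

/-- The simple root `α_i` as an element of the weight lattice. -/
def simpleRoot (i : I) : L.P := ⟨R.root i, L.root_mem i⟩

/-- The integer `⟨h_i, λ⟩` for a weight `λ`. -/
def pairing (i : I) (v : L.P) : ℤ := (L.integral i v v.2).choose

theorem pairing_spec (i : I) (v : L.P) :
    (v : Module.Dual ℂ 𝔥) (R.coroot i) = (L.pairing i v : ℂ) :=
  (L.integral i v v.2).choose_spec

end WeightLattice

/-- `(B, wt, ε, φ, e, f)` is a Kashiwara crystal for the generalized Cartan matrix `A` and the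
weight lattice `L`. Here `WithBot ℤ` is `ℤ ⊔ {-∞}`, with `-∞ + x = -∞`, and `Option B` is
`B ⊔ {0}`, with `none` in the role of `0`. -/
structure IsCrystal {R : Realization A 𝔥} (L : WeightLattice R) {B : Type*} (wt : B → L.P)
    (ε φ : I → B → WithBot ℤ) (e f : I → B → Option B) : Prop where
  isGCM : IsGCM A
  phi_eq : ∀ i b, φ i b = ε i b + ((L.pairing i (wt b) : ℤ) : WithBot ℤ)
  e_apply : ∀ i b b', e i b = some b' →
    wt b' = wt b + L.simpleRoot i ∧
    ε i b' = ε i b + ((-1 : ℤ) : WithBot ℤ) ∧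
    φ i b' = φ i b + ((1 : ℤ) : WithBot ℤ)
  f_apply : ∀ i b b', f i b = some b' →
    wt b' = wt b - L.simpleRoot i ∧
    ε i b' = ε i b + ((1 : ℤ) : WithBot ℤ) ∧
    φ i b' = φ i b + ((-1 : ℤ) : WithBot ℤ)
  e_iff_f : ∀ i b b', e i b' = some b ↔ f i b = some b'
  bot : ∀ i b, φ i b = ⊥ → e i b = none ∧ f i b = none

end Crystals

/-! ## The equioriented commutative grid -/

section Grid

variable {d : ℕ}

/-- The vertices `[1, m_1] × ⋯ × [1, m_d]` of the grid, with coordinates counted from `0`. -/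
def Vertex (m : Fin d → ℕ) : Type := ∀ l, Fin (m l)

instance (m : Fin d → ℕ) : Fintype (Vertex m) := inferInstanceAs (Fintype (∀ l, Fin (m l)))

instance (m : Fin d → ℕ) : DecidableEq (Vertex m) :=
  inferInstanceAs (DecidableEq (∀ l, Fin (m l)))

variable {m : Fin d → ℕ}

/-- There is an arrow `i → j` if `j` is obtained from `i` by raising one coordinate by one. -/
def IsArrow (i j : Vertex m) : Prop :=
  ∃ l, (i l : ℕ) + 1 = (j l : ℕ) ∧ ∀ k, k ≠ l → i k = j k

/-- The quiver of the grid: at most one arrow between two vertices. -/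
instance : Quiver (Vertex m) where
  Hom i j := PLift (IsArrow i j)

/-- The lexicographic order on the vertices. -/
def LexLT (i j : Vertex m) : Prop :=
  @toLex (∀ l, Fin (m l)) i < @toLex (∀ l, Fin (m l)) j

/-- The generalized Cartan matrix of the quiver: `2` on the diagonal, and minus the number of
arrows between `i` and `j`, in both directions, off the diagonal. -/
def cartan (m : Fin d → ℕ) : Matrix (Vertex m) (Vertex m) ℤ := fun i j =>
  if i = j then 2 else -(Nat.card (i ⟶ j) : ℤ) - (Nat.card (j ⟶ i) : ℤ)

end Grid

/-! ## Representations and the representation variety -/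

section Representations

variable {d : ℕ} {m : Fin d → ℕ} (k K : Type*) [Field k] [Field K] [Algebra k K]

/-- The space `∏_{τ ∈ E} Hom(K^{ν_{s(τ)}}, K^{ν_{t(τ)}})`. -/
abbrev Rep (ν : Vertex m → ℕ) : Type _ :=
  ∀ ⦃i j : Vertex m⦄, (i ⟶ j) → ((Fin (ν i) → K) →ₗ[K] (Fin (ν j) → K))

variable {K} in
/-- The evaluation of a representation on a path. -/
def Rep.eval {ν : Vertex m → ℕ} (f : Rep K ν) {i : Vertex m} :
    ∀ {j : Vertex m}, Quiver.Path i j → ((Fin (ν i) → K) →ₗ[K] (Fin (ν j) → K))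
  | _, .nil => LinearMap.id
  | _, .cons p τ => f τ ∘ₗ Rep.eval f p

variable {K} in
/-- The commutative relations: any two parallel paths are identical. -/
def Rep.Commutes {ν : Vertex m → ℕ} (f : Rep K ν) : Prop :=
  ∀ (i j : Vertex m) (p q : Quiver.Path i j), f.eval p = f.eval q

/-- The indices of the matrix entries of a representation with dimension vector `ν`. -/
abbrev Entry (ν : Vertex m → ℕ) : Type :=
  Σ e : (Σ i j : Vertex m, (i ⟶ j)), Fin (ν e.2.1) × Fin (ν e.1)

variable {K} in
/-- The matrix entries of a representation. -/
def Rep.entries {ν : Vertex m → ℕ} (f : Rep K ν) : Entry ν → K :=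
  fun c => LinearMap.toMatrix' (f c.1.2.2) c.2.1 c.2.2

/-- The Zariski topology over `k` on the affine space `K^σ`: the closed sets are the sets of
common zeros in `K^σ` of polynomials with coefficients in `k`. -/
abbrev zariskiTopology (σ : Type*) : TopologicalSpace (σ → K) :=
  TopologicalSpace.ofClosed (Set.range (MvPolynomial.zeroLocus (k := k) (σ := σ) K))
    ⟨⊤, MvPolynomial.zeroLocus_top⟩
    (by
      intro T hT
      refine ⟨Ideal.span {p | ∃ I : Ideal (MvPolynomial σ k),
        MvPolynomial.zeroLocus K I ∈ T ∧ p ∈ I}, ?_⟩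
      ext x
      rw [MvPolynomial.zeroLocus_span]
      simp only [Set.mem_ofPred_eq, Set.mem_sInter]
      constructor
      · intro h Z hZ
        obtain ⟨I, rfl⟩ := hT hZ
        exact fun p hp => h p ⟨I, hZ, hp⟩
      · rintro h p ⟨I, hI, hp⟩
        exact h _ hI p hp)
    (by
      rintro _ ⟨I, rfl⟩ _ ⟨J, rfl⟩
      refine ⟨I * J, ?_⟩
      ext x
      simp only [MvPolynomial.mem_zeroLocus_iff, Set.mem_union]
      constructor
      · intro h
        by_contra hc
        push Not at hc
        obtain ⟨⟨p, hp, hpx⟩, q, hq, hqx⟩ := hc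
        have := h (p * q) (Ideal.mul_mem_mul hp hq)
        rw [map_mul] at this
        exact (mul_ne_zero hpx hqx) this
      · rintro (h | h) p hp
        · exact h p ((Ideal.mul_le_left : I * J ≤ I) hp)
        · exact h p ((Ideal.mul_le_right : I * J ≤ J) hp))

/-- The representation variety `E_C(ν)`, as the set of its `K`-points. Its topology is the
Zariski topology over the base field `k`, defined below. -/
def EC (_k K : Type*) [Field K] (ν : Vertex m → ℕ) : Type _ := {f : Rep K ν // f.Commutes}

instance (ν : Vertex m → ℕ) : TopologicalSpace (EC k K ν) :=
  (zariskiTopology k K (Entry ν)).induced (fun f => Rep.entries f.1)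

/-- `B_C = ⨆_ν B_C(ν)`, where `B_C(ν)` is the set of irreducible components of `E_C(ν)`. The
weight `ν = - ∑ ν_i α_i` is recorded by the dimension vector `(ν_i)`. -/
abbrev BC (m : Fin d → ℕ) : Type _ :=
  Σ ν : Vertex m → ℕ, {Λ : Set (EC k K ν) // Λ ∈ irreducibleComponents (EC k K ν)}

end Representations

/-! ## The correspondence given by extensions -/

section Extensions

variable {d : ℕ} {m : Fin d → ℕ} (k K : Type*) [Field K]

/-- The variety `E'_C(a, b)` of extensions, with dimension vectors `a` of the subrepresentation
and `b` of the quotient. The dimension vector `n` of the representation in the middle is kept as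
a parameter; exactness forces `n = a + b`, and there are no points for other `n`. -/
structure ExtPoint (a b n : Vertex m → ℕ) where
  sub : ∀ j, (Fin (a j) → K) →ₗ[K] (Fin (n j) → K)
  quot : ∀ j, (Fin (n j) → K) →ₗ[K] (Fin (b j) → K)
  rep : Rep K n
  injective : ∀ j, Function.Injective (sub j)
  exact : ∀ j, Function.Exact (sub j) (quot j)
  surjective : ∀ j, Function.Surjective (quot j)
  commutes : rep.Commutes
  stable : ∀ (i j : Vertex m) (τ : i ⟶ j),
    LinearMap.range (rep τ ∘ₗ sub i) ≤ LinearMap.range (sub j)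

variable {K} {a b n : Vertex m → ℕ}

/-- The map induced on the quotients along an arrow. -/
theorem ExtPoint.exists_quotMap (x : ExtPoint K a b n) {i j : Vertex m} (τ : i ⟶ j) :
    ∃ g : (Fin (b i) → K) →ₗ[K] (Fin (b j) → K), g ∘ₗ x.quot i = x.quot j ∘ₗ x.rep τ := by
  obtain ⟨s, hs⟩ := (x.quot i).exists_rightInverse_of_surjective
    (LinearMap.range_eq_top.2 (x.surjective i))
  refine ⟨x.quot j ∘ₗ x.rep τ ∘ₗ s, LinearMap.ext fun v => ?_⟩
  have h0 : x.quot i (s (x.quot i v) - v) = 0 := by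
    have := LinearMap.congr_fun hs (x.quot i v)
    simp only [LinearMap.comp_apply, LinearMap.id_apply] at this
    rw [map_sub, this, sub_self]
  obtain ⟨w, hw⟩ := (x.exact i _).1 h0
  obtain ⟨u, hu⟩ := x.stable i j τ ⟨w, rfl⟩
  have h1 : x.quot j (x.rep τ (s (x.quot i v) - v)) = 0 := by
    rw [← hw]
    exact (x.exact j _).2 ⟨u, hu⟩
  rw [map_sub, map_sub, sub_eq_zero] at h1
  exact h1

/-- The quotient representation `f'` of a point of the variety of extensions: the unique
representation with `f'_τ ∘ φ'_{s(τ)} = φ'_{t(τ)} ∘ f_τ`. -/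
def ExtPoint.quotRep (x : ExtPoint K a b n) : Rep K b := fun _ _ τ => (x.exists_quotMap τ).choose

theorem ExtPoint.quotRep_comp (x : ExtPoint K a b n) {i j : Vertex m} (τ : i ⟶ j) :
    x.quotRep τ ∘ₗ x.quot i = x.quot j ∘ₗ x.rep τ :=
  (x.exists_quotMap τ).choose_spec

theorem ExtPoint.quotRep_eval (x : ExtPoint K a b n) {i j : Vertex m} (p : Quiver.Path i j) :
    x.quotRep.eval p ∘ₗ x.quot i = x.quot j ∘ₗ x.rep.eval p := by
  induction p with
  | nil => rfl
  | cons p τ ih =>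
    simp only [Rep.eval]
    rw [LinearMap.comp_assoc, ih, ← LinearMap.comp_assoc, x.quotRep_comp, LinearMap.comp_assoc]

theorem ExtPoint.quotRep_commutes (x : ExtPoint K a b n) : x.quotRep.Commutes := by
  intro i j p q
  rw [← LinearMap.cancel_right (x.surjective i), x.quotRep_eval, x.quotRep_eval,
    x.commutes i j p q]

/-- `ϖ₃`: the quotient representation. -/
def varpi3 (x : ExtPoint K a b n) : EC k K b := ⟨x.quotRep, x.quotRep_commutes⟩

/-- `ϖ₄`: the representation in the middle. -/
def varpi4 (x : ExtPoint K a b n) : EC k K n := ⟨x.rep, x.commutes⟩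

end Extensions

/-! ## The star-crystal data -/

section StarCrystal

variable {d : ℕ} {m : Fin d → ℕ} {k K : Type*} [Field k] [Field K] [Algebra k K]

/-- `ε*_i(f)`: the dimension of the kernel of
`(f_τ)_{s(τ) = i} : K^{ν_i} → ⨁_{s(τ) = i} K^{ν_{t(τ)}}`. -/
def epsStarPt {ν : Vertex m → ℕ} (i : Vertex m) (f : EC k K ν) : ℕ :=
  Module.finrank K (LinearMap.ker
    (LinearMap.pi (fun τ : (Σ j : Vertex m, (i ⟶ j)) => f.1 τ.2)))

/-- `in₁(i)`. -/
def in1 (i : Vertex m) : Set (Vertex m) := {j | IsArrow j i}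

/-- `in₂(i)`. -/
def in2 (i : Vertex m) : Set (Vertex m) :=
  {l | ∃ j₁ ∈ in1 i, ∃ j₂ ∈ in1 i, j₁ ≠ j₂ ∧ IsArrow l j₁ ∧ IsArrow l j₂}

/-- The transpose of a linear map between coordinate spaces. -/
def transposeMap {p q : ℕ} (g : (Fin p → K) →ₗ[K] (Fin q → K)) :
    (Fin q → K) →ₗ[K] (Fin p → K) :=
  Matrix.toLin' (LinearMap.toMatrix' g).transpose

open Classical in
/-- The component `K^{ν_j} → K^{ν_l}` of `F_i(f)`, for `j ∈ in₁(i)` and `l ∈ in₂(i)`: it is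
`f_{(l,j)}ᵀ` if `l` is the common source `k(j, j')` of arrows to `j` and to some `j' ∈ in₁(i)`
with `j < j'`, it is `-f_{(l,j)}ᵀ` if this holds with `j' < j`, and `0` otherwise. -/
def FStarComp {ν : Vertex m → ℕ} (i : Vertex m) (f : EC k K ν) (j l : Vertex m) :
    (Fin (ν j) → K) →ₗ[K] (Fin (ν l) → K) :=
  if h : IsArrow l j ∧ ∃ j' ∈ in1 i, LexLT j j' ∧ IsArrow l j' then
    transposeMap (f.1 (PLift.up h.1))
  else if h : IsArrow l j ∧ ∃ j' ∈ in1 i, LexLT j' j ∧ IsArrow l j' then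
    -transposeMap (f.1 (PLift.up h.1))
  else 0

open Classical in
/-- `F_i(f) : ⨁_{j ∈ in₁(i)} K^{ν_j} → ⨁_{l ∈ in₂(i)} K^{ν_l}`. -/
def FStar {ν : Vertex m → ℕ} (i : Vertex m) (f : EC k K ν) :
    ((j : in1 i) → Fin (ν j) → K) →ₗ[K] ((l : in2 i) → Fin (ν l) → K) :=
  LinearMap.pi fun l => ∑ j : in1 i, FStarComp i f j l ∘ₗ LinearMap.proj j

/-- The space `(ker F_i(f))*`, which parametrizes the extensions by a simple subrepresentation
at `i`. -/
abbrev ExtStar {ν : Vertex m → ℕ} (i : Vertex m) (f : EC k K ν) : Type _ :=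
  Module.Dual K (LinearMap.ker (FStar i f))

/-- The points of `Λ` at which `g` takes its minimum on `Λ`. -/
def minLocus {X : Type*} (g : X → ℕ) (Λ : Set X) : Set X := {x ∈ Λ | ∀ y ∈ Λ, g x ≤ g y}

/-- `Λ³`: the points `f` of `Λ` where `dim (ker F_i(f))*` is minimal. -/
def locus3 {ν : Vertex m → ℕ} (i : Vertex m) (Λ : Set (EC k K ν)) : Set (EC k K ν) :=
  minLocus (fun f => Module.finrank K (ExtStar i f)) Λ

/-- `Λ⁴`: the points of `Λ` where `ε*_i` is minimal. -/
def locus4 {ν : Vertex m → ℕ} (i : Vertex m) (Λ : Set (EC k K ν)) : Set (EC k K ν) :=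
  minLocus (epsStarPt i) Λ

/-- `ε*_i(Λ)`: the minimum of `ε*_i` on the (non-empty) component `Λ`. -/
def epsStarNat (i : Vertex m) (b : BC k K m) : ℕ := sInf (epsStarPt i '' b.2.1)

/-- `ε*_i` with values in `ℤ ⊔ {-∞}`. -/
def epsStar (i : Vertex m) (b : BC k K m) : WithBot ℤ := ((epsStarNat i b : ℤ) : WithBot ℤ)

/-- The dimension vector `δ_i` of the simple representation at `i`, that is, of the weight
`-α_i`. -/
abbrev simpleDim (i : Vertex m) : Vertex m → ℕ := Pi.single i 1

/-- The closure of `ϖ₄(ϖ₃⁻¹(Λ³))` for `Λ ⊂ E_C(μ)`, in the correspondence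
`E_C(μ) ← E'_C(δ_i, μ) → E_C(μ + δ_i)`. -/
def fStarSet (i : Vertex m) {μ : Vertex m → ℕ} (Λ : Set (EC k K μ)) :
    Set (EC k K (μ + simpleDim i)) :=
  closure (varpi4 k '' ((varpi3 k : ExtPoint K (simpleDim i) μ (μ + simpleDim i) → EC k K μ) ⁻¹'
    locus3 i Λ))

/-- The closure of `ϖ₃(ϖ₄⁻¹(Λ⁴))` for `Λ ⊂ E_C(ν)`, in the correspondence
`E_C(ν - δ_i) ← E'_C(δ_i, ν - δ_i) → E_C(ν)`. It is used only if `ν_i > 0`. -/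
def eStarSet (i : Vertex m) {ν : Vertex m → ℕ} (Λ : Set (EC k K ν)) :
    Set (EC k K (ν - simpleDim i)) :=
  closure (varpi3 k '' ((varpi4 k : ExtPoint K (simpleDim i) (ν - simpleDim i) ν → EC k K ν) ⁻¹'
    locus4 i Λ))

open Classical in
/-- The operator `f̃*_i`. -/
def fStar (i : Vertex m) (b : BC k K m) : Option (BC k K m) :=
  if h : fStarSet i b.2.1 ∈ irreducibleComponents (EC k K (b.1 + simpleDim i)) then
    some ⟨b.1 + simpleDim i, fStarSet i b.2.1, h⟩
  else none

open Classical in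
/-- The operator `ẽ*_i`. -/
def eStar (i : Vertex m) (b : BC k K m) : Option (BC k K m) :=
  if h : 0 < epsStarNat i b ∧
      eStarSet i b.2.1 ∈ irreducibleComponents (EC k K (b.1 - simpleDim i)) then
    some ⟨b.1 - simpleDim i, eStarSet i b.2.1, h.2⟩
  else none

variable {𝔥 : Type*} [AddCommGroup 𝔥] [Module ℂ 𝔥] {R : Realization (cartan m) 𝔥}

/-- The weight `- ∑ ν_i α_i` of a component of `E_C(ν)`. -/
def weight (L : WeightLattice R) (b : BC k K m) : L.P :=
  -∑ i : Vertex m, (b.1 i : ℤ) • L.simpleRoot i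

/-- `φ*_i(Λ) = ε*_i(Λ) + ⟨h_i, wt(Λ)⟩`. -/
def phiStar (L : WeightLattice R) (i : Vertex m) (b : BC k K m) : WithBot ℤ :=
  epsStar i b + ((L.pairing i (weight L b) : ℤ) : WithBot ℤ)

end StarCrystal

end PersistenceCrystal

end

/-! The point is that `ϖ₃⁻¹(Λ³)` and `ϖ₄⁻¹(Λ⁴)` have irreducible images. Up to a change of frames,
the extensions of `f'` by the simple representation at `i` form the vector space `ker F_i(f')`, and
the quotients of `f` by a simple subrepresentation at `i` are given by vectors in the kernel of the
map defining `ε*_i(f)`. A family of kernels of constant dimension over an irreducible base is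
irreducible: by Cramer's rule it is locally parametrized by polynomials, and `K` is infinite. As
`ε*_i` and `dim (ker F_i)*` are upper semicontinuous, `Λ³` and `Λ⁴` are open and dense in `Λ`, so
comparing dense subsets shows that `ẽ*_i` and `f̃*_i` are partial inverses of each other. Passing
to an extension by the simple representation raises `ε*_i` by one, which gives the remaining
properties. -/

noncomputable section

namespace PersistenceCrystal

/-! ### Nonvanishing minors and the kernel of a matrix -/

section Minors

variable {ρ σ n : Type*}

theorem exists_linearIndependent_submatrix_row {K : Type*} [Field K] [Finite ρ] [Fintype σ]
    (M : Matrix ρ σ K) {r : ℕ} (hr : M.rank = r) :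
    ∃ R : Fin r → ρ, LinearIndependent K (M.submatrix R id).row := by
  obtain ⟨v, hv, -, hli⟩ := Submodule.exists_fun_fin_finrank_span_eq K (Set.range M.row)
  choose R hR using hv
  have hspan : r = Module.finrank K (Submodule.span K (Set.range M.row)) := by
    rw [← hr, M.rank_eq_finrank_span_row]
  have hrow : (M.submatrix (R ∘ Fin.cast hspan) id).row = v ∘ Fin.cast hspan :=
    funext fun i => hR _
  exact ⟨R ∘ Fin.cast hspan, hrow ▸ hli.comp _ (Fin.cast_injective _)⟩

theorem exists_submatrix_det_ne_zero {K : Type*} [Field K] [Finite ρ] [Fintype σ]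
    (M : Matrix ρ σ K) {r : ℕ} (hr : M.rank = r) :
    ∃ (R : Fin r → ρ) (C : Fin r → σ), (M.submatrix R C).det ≠ 0 := by
  cases nonempty_fintype ρ
  obtain ⟨R, hR⟩ := exists_linearIndependent_submatrix_row M hr
  obtain ⟨C, hC⟩ := exists_linearIndependent_submatrix_row (M.submatrix R id).transpose
    (by rw [Matrix.rank_transpose, hR.rank_matrix, Fintype.card_fin])
  refine ⟨R, C, ?_⟩
  rw [← Matrix.det_transpose]
  exact ((Matrix.isUnit_iff_isUnit_det _).1 (Matrix.linearIndependent_rows_iff_isUnit.1 hC)).ne_zero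

theorem rank_add_finrank_ker {K : Type*} [Field K] [Fintype σ] (M : Matrix ρ σ K) :
    M.rank + Module.finrank K (LinearMap.ker M.mulVecLin) = Fintype.card σ := by
  rw [Matrix.rank, M.mulVecLin.finrank_range_add_finrank_ker, Module.finrank_fintype_fun_eq_card]

theorem rank_eq_iff_finrank_ker_eq {K : Type*} [Field K] [Fintype σ] {M N : Matrix ρ σ K} :
    M.rank = N.rank ↔ Module.finrank K (LinearMap.ker M.mulVecLin) =
      Module.finrank K (LinearMap.ker N.mulVecLin) := by
  have hM := rank_add_finrank_ker M
  have hN := rank_add_finrank_ker N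
  lia

variable [Fintype n] [DecidableEq n]

theorem card_le_rank_of_submatrix_det_ne_zero {K : Type*} [Field K] [Fintype σ]
    {M : Matrix ρ σ K} {R : n → ρ} {C : n → σ} (h : (M.submatrix R C).det ≠ 0) :
    Fintype.card n ≤ M.rank :=
  (Matrix.rank_of_det_ne_zero h).symm.trans_le (Matrix.rank_submatrix_le _ _ _)

variable [DecidableEq σ]

/-- The Cramer matrix of `M` for the minor with rows `R` and columns `C`: with `Q` that square
submatrix, `M_R` the rows `R` of `M` and `E` the inclusion of the coordinates `C`, it is
`det Q - E (adj Q) M_R`. Its columns span the kernel of `M` when `det Q` is invertible and the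
rank of `M` is the size of `Q`. -/
def cramerKernel {B : Type*} [CommRing B] (M : Matrix ρ σ B) (R : n → ρ) (C : n → σ) :
    Matrix σ σ B :=
  (M.submatrix R C).det • 1 -
    (1 : Matrix σ σ B).submatrix id C * (M.submatrix R C).adjugate * M.submatrix R id

theorem map_cramerKernel {B B' : Type*} [CommRing B] [CommRing B'] (g : B →+* B')
    (M : Matrix ρ σ B) (R : n → ρ) (C : n → σ) :
    (cramerKernel M R C).map g = cramerKernel (M.map g) R C := by
  have hdet : g (M.submatrix R C).det = ((M.map g).submatrix R C).det := g.map_det _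
  have hadj : (M.submatrix R C).adjugate.map g = ((M.map g).submatrix R C).adjugate :=
    g.map_adjugate _
  have hone : (1 : Matrix σ σ B).map g = 1 := Matrix.map_one g g.map_zero g.map_one
  have hsmul : ((M.submatrix R C).det • (1 : Matrix σ σ B)).map g =
      g (M.submatrix R C).det • 1 := by
    rw [Matrix.map_smulₛₗ g g _ fun _ => g.map_mul _ _, hone]
  rw [cramerKernel, cramerKernel, Matrix.map_sub _ g.map_sub, Matrix.map_mul, Matrix.map_mul, hadj,
    hsmul, hdet, ← Matrix.submatrix_map, hone, ← Matrix.submatrix_map]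

variable [Fintype σ]

theorem submatrix_mul_cramerKernel {B : Type*} [CommRing B] (M : Matrix ρ σ B) (R : n → ρ)
    (C : n → σ) : M.submatrix R id * cramerKernel M R C = 0 := by
  have hcols : M.submatrix R id * (1 : Matrix σ σ B).submatrix id C = M.submatrix R C := by
    rw [← Matrix.submatrix_mul _ _ _ _ _ Function.bijective_id, Matrix.mul_one]
  rw [cramerKernel, Matrix.mul_sub, ← Matrix.mul_assoc, ← Matrix.mul_assoc, hcols,
    Matrix.mul_adjugate, Matrix.mul_smul, Matrix.mul_one, Matrix.smul_mul, Matrix.one_mul, sub_self]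

theorem cramerKernel_mulVec {B : Type*} [CommRing B] {M : Matrix ρ σ B} (R : n → ρ) (C : n → σ)
    {w : σ → B} (hw : M.mulVec w = 0) :
    (cramerKernel M R C).mulVec w = (M.submatrix R C).det • w := by
  have hrows : (M.submatrix R id).mulVec w = 0 := funext fun i => congrFun hw (R i)
  rw [cramerKernel, Matrix.sub_mulVec, ← Matrix.mulVec_mulVec, hrows, Matrix.mulVec_zero, sub_zero,
    Matrix.smul_mulVec, Matrix.one_mulVec]

theorem mul_cramerKernel {K : Type*} [Field K] {M : Matrix ρ σ K} {R : n → ρ} {C : n → σ}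
    (h : (M.submatrix R C).det ≠ 0) (hr : M.rank = Fintype.card n) :
    M * cramerKernel M R C = 0 := by
  have hle : LinearMap.ker M.mulVecLin ≤ LinearMap.ker (M.submatrix R id).mulVecLin :=
    fun w hw => funext fun i => congrFun hw (R i)
  have hrank : Fintype.card n ≤ (M.submatrix R id).rank :=
    card_le_rank_of_submatrix_det_ne_zero (R := id) (C := C) h
  have hker : LinearMap.ker M.mulVecLin = LinearMap.ker (M.submatrix R id).mulVecLin := by
    refine Submodule.eq_of_le_of_finrank_le hle ?_
    have h₁ := rank_add_finrank_ker M
    have h₂ := rank_add_finrank_ker (M.submatrix R id)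
    lia
  refine Matrix.ext_of_mulVec_single fun s => ?_
  rw [← Matrix.mulVec_mulVec, Matrix.zero_mulVec]
  have hs : (cramerKernel M R C).mulVec (Pi.single s 1) ∈
      LinearMap.ker (M.submatrix R id).mulVecLin := by
    rw [LinearMap.mem_ker, Matrix.mulVecLin_apply, Matrix.mulVec_mulVec,
      submatrix_mul_cramerKernel, Matrix.zero_mulVec]
  exact hker.ge hs

end Minors

/-! ### Irreducibility with respect to a ring of functions -/

section RegularFunctions

variable {k K : Type*} [CommRing k] [Field K] [Algebra k K] {X Y Z τ : Type*}

/-- The set `S` is preirreducible in the topology on `X` whose basic open sets are the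
nonvanishing loci of the functions in `A`. Working with `A` rather than with the topology makes it
possible to treat the products `X × K^τ` (whose topology is not the product topology) without
type synonyms. -/
def IsPreirreducibleFor (A : Subalgebra k (X → K)) (S : Set X) : Prop :=
  ∀ a ∈ A, ∀ b ∈ A, (∃ x ∈ S, a x ≠ 0) → (∃ x ∈ S, b x ≠ 0) → ∃ x ∈ S, a x ≠ 0 ∧ b x ≠ 0

variable {A : Subalgebra k (X → K)} {B : Subalgebra k (Y → K)} {S : Set X}

theorem IsPreirreducibleFor.inter_ne_zero (hS : IsPreirreducibleFor A S) {u : X → K}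
    (hu : u ∈ A) : IsPreirreducibleFor A {x ∈ S | u x ≠ 0} := by
  rintro a ha b hb ⟨x, ⟨hx, hux⟩, hax⟩ ⟨y, ⟨hy, -⟩, hby⟩
  obtain ⟨z, hz, h, hbz⟩ := hS (u * a) (A.mul_mem hu ha) b hb ⟨x, hx, mul_ne_zero hux hax⟩
    ⟨y, hy, hby⟩
  exact ⟨z, ⟨hz, left_ne_zero_of_mul h⟩, right_ne_zero_of_mul h, hbz⟩

theorem isPreirreducibleFor_of_cover {ι : Type*} {u : ι → X → K} (hu : ∀ i, u i ∈ A)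
    (hcover : ∀ x ∈ S, ∃ i, u i x ≠ 0) (hmeet : ∀ i j, ∃ x ∈ S, u i x ≠ 0 ∧ u j x ≠ 0)
    (hirr : ∀ i, IsPreirreducibleFor A {x ∈ S | u i x ≠ 0}) : IsPreirreducibleFor A S := by
  rintro a ha b hb ⟨x, hx, hax⟩ ⟨y, hy, hby⟩
  obtain ⟨i, hi⟩ := hcover x hx
  obtain ⟨j, hj⟩ := hcover y hy
  obtain ⟨z, hz, hiz, hjz⟩ := hmeet i j
  obtain ⟨x', ⟨hx', -⟩, hax', hjx'⟩ :=
    hirr i a ha (u j) (hu j) ⟨x, ⟨hx, hi⟩, hax⟩ ⟨z, ⟨hz, hiz⟩, hjz⟩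
  obtain ⟨y', ⟨hy', -⟩, h⟩ := hirr j a ha b hb ⟨x', ⟨hx', hjx'⟩, hax'⟩ ⟨y, ⟨hy, hj⟩, hby⟩
  exact ⟨y', hy', h⟩

variable (A S) in
/-- The functions on `S` which are quotients of restrictions of functions in `A`. -/
def regularOn : Subalgebra k (S → K) where
  carrier := {g | ∃ u ∈ A, ∃ a ∈ A, ∀ x : S, u x ≠ 0 ∧ u x * g x = a x}
  mul_mem' := by
    rintro g g' ⟨u, hu, a, ha, h⟩ ⟨u', hu', a', ha', h'⟩
    refine ⟨u * u', A.mul_mem hu hu', a * a', A.mul_mem ha ha', fun x => ?_⟩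
    simp only [Pi.mul_apply, ← (h x).2, ← (h' x).2]
    exact ⟨mul_ne_zero (h x).1 (h' x).1, by ring⟩
  add_mem' := by
    rintro g g' ⟨u, hu, a, ha, h⟩ ⟨u', hu', a', ha', h'⟩
    refine ⟨u * u', A.mul_mem hu hu', a * u' + u * a',
      A.add_mem (A.mul_mem ha hu') (A.mul_mem hu ha'), fun x => ?_⟩
    simp only [Pi.mul_apply, Pi.add_apply, ← (h x).2, ← (h' x).2]
    exact ⟨mul_ne_zero (h x).1 (h' x).1, by ring⟩
  algebraMap_mem' c := ⟨1, A.one_mem, _, A.algebraMap_mem c, fun x => by simp⟩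

theorem restrict_mem_regularOn {a : X → K} (ha : a ∈ A) : (fun x : S => a x) ∈ regularOn A S :=
  ⟨1, A.one_mem, a, ha, fun x => by simp⟩

theorem isUnit_of_forall_ne_zero {g : regularOn A S} (hg : ∀ x, (g : S → K) x ≠ 0) : IsUnit g := by
  obtain ⟨g, u, hu, a, ha, h⟩ := g
  have hinv : g⁻¹ ∈ regularOn A S := by
    refine ⟨a, ha, u, hu, fun x => ?_⟩
    rw [← (h x).2, Pi.inv_apply, mul_inv_cancel_right₀ (hg x)]
    exact ⟨mul_ne_zero (h x).1 (hg x), rfl⟩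
  exact IsUnit.of_mul_eq_one ⟨_, hinv⟩
    (Subtype.ext (funext fun x => mul_inv_cancel₀ (hg x)))

theorem IsPreirreducibleFor.regularOn_univ (hS : IsPreirreducibleFor A S) :
    IsPreirreducibleFor (regularOn A S) Set.univ := by
  rintro g ⟨u, -, a, ha, h⟩ g' ⟨u', -, a', ha', h'⟩ ⟨x, -, hgx⟩ ⟨y, -, hgy⟩
  obtain ⟨z, hz, haz, haz'⟩ := hS a ha a' ha'
    ⟨x, x.2, (h x).2 ▸ mul_ne_zero (h x).1 hgx⟩ ⟨y, y.2, (h' y).2 ▸ mul_ne_zero (h' y).1 hgy⟩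
  rw [← (h ⟨z, hz⟩).2] at haz
  rw [← (h' ⟨z, hz⟩).2] at haz'
  exact ⟨⟨z, hz⟩, trivial, right_ne_zero_of_mul haz, right_ne_zero_of_mul haz'⟩

theorem IsPreirreducibleFor.range (hS : IsPreirreducibleFor A S) {φ : S → Y}
    (hφ : ∀ b ∈ B, b ∘ φ ∈ regularOn A S) : IsPreirreducibleFor B (Set.range φ) := by
  rintro b hb b' hb' ⟨_, ⟨x, rfl⟩, hx⟩ ⟨_, ⟨y, rfl⟩, hy⟩
  obtain ⟨z, -, hz⟩ := hS.regularOn_univ _ (hφ b hb) _ (hφ b' hb') ⟨x, trivial, hx⟩ ⟨y, trivial, hy⟩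
  exact ⟨φ z, ⟨z, rfl⟩, hz⟩

/-! ### Functions on products with affine spaces -/

/-- The evaluation of the functions in `A` at a point. -/
def evalAt (A : Subalgebra k (X → K)) (x : X) : A →+* K :=
  (Pi.evalRingHom (fun _ : X => K) x).comp A.val.toRingHom

@[simp]
theorem evalAt_apply (x : X) (a : A) : evalAt A x a = (a : X → K) x := rfl

variable (A) in
/-- The polynomial functions on `X × K^τ` with coefficients in `A`. -/
def polyExt (τ : Type*) : Subalgebra k (X × (τ → K) → K) where
  carrier := {g | ∃ P : MvPolynomial τ A, ∀ p, g p = P.eval₂ (evalAt A p.1) p.2}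
  mul_mem' := by
    rintro _ _ ⟨P, hP⟩ ⟨Q, hQ⟩
    exact ⟨P * Q, fun p => by simp [hP, hQ]⟩
  add_mem' := by
    rintro _ _ ⟨P, hP⟩ ⟨Q, hQ⟩
    exact ⟨P + Q, fun p => by simp [hP, hQ]⟩
  algebraMap_mem' c := ⟨MvPolynomial.C (algebraMap k A c), fun p => by simp⟩

theorem comp_fst_mem_polyExt {a : X → K} (ha : a ∈ A) : a ∘ Prod.fst ∈ polyExt A τ :=
  ⟨MvPolynomial.C ⟨a, ha⟩, fun p => by simp⟩

theorem coord_mem_polyExt (t : τ) : (fun p : X × (τ → K) => p.2 t) ∈ polyExt A τ :=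
  ⟨MvPolynomial.X t, fun p => by simp⟩

theorem comp_mem_of_mem_polyExt {C : Subalgebra k (Z → K)} {φ : Z → X × (τ → K)}
    (hfst : ∀ a ∈ A, (fun z => a (φ z).1) ∈ C) (hsnd : ∀ t, (fun z => (φ z).2 t) ∈ C)
    {b : X × (τ → K) → K} (hb : b ∈ polyExt A τ) : b ∘ φ ∈ C := by
  obtain ⟨P, hP⟩ := hb
  obtain rfl : b = fun p => P.eval₂ (evalAt A p.1) p.2 := funext hP
  clear hP
  induction P using MvPolynomial.induction_on with
  | C a => simpa [Function.comp_def] using hfst a a.2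
  | add P Q hP hQ => simpa [Function.comp_def] using! C.add_mem hP hQ
  | mul_X P t hP => simpa [Function.comp_def] using! C.mul_mem hP (hsnd t)

theorem exists_mem_forall_map_evalAt_ne_zero {P : MvPolynomial τ A} {x : X}
    (hP : P.map (evalAt A x) ≠ 0) :
    ∃ u ∈ A, u x ≠ 0 ∧ ∀ y, u y ≠ 0 → P.map (evalAt A y) ≠ 0 := by
  obtain ⟨s, hs⟩ := MvPolynomial.ne_zero_iff.1 hP
  rw [MvPolynomial.coeff_map] at hs
  refine ⟨(P.coeff s).1, (P.coeff s).2, hs, fun y hy => MvPolynomial.ne_zero_iff.2 ⟨s, ?_⟩⟩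
  rwa [MvPolynomial.coeff_map]

theorem IsPreirreducibleFor.prod [Infinite K] (hS : IsPreirreducibleFor A S) :
    IsPreirreducibleFor (polyExt A τ) {p | p.1 ∈ S} := by
  rintro a ⟨P, hP⟩ b ⟨Q, hQ⟩ ⟨⟨x, w⟩, hx, hax⟩ ⟨⟨y, v⟩, hy, hby⟩
  simp only [hP, hQ, MvPolynomial.eval₂_eq_eval_map] at hax hby ⊢
  obtain ⟨u, hu, hux, huP⟩ :=
    exists_mem_forall_map_evalAt_ne_zero (P := P) (x := x) (by rintro h; simp [h] at hax)
  obtain ⟨u', hu', huy, huQ⟩ :=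
    exists_mem_forall_map_evalAt_ne_zero (P := Q) (x := y) (by rintro h; simp [h] at hby)
  obtain ⟨z, hz, huz, huz'⟩ := hS u hu u' hu' ⟨x, hx, hux⟩ ⟨y, hy, huy⟩
  obtain ⟨w, hw⟩ : ∃ w, MvPolynomial.eval w (P.map (evalAt A z) * Q.map (evalAt A z)) ≠ 0 := by
    by_contra! h
    exact mul_ne_zero (huP z huz) (huQ z huz') (MvPolynomial.funext fun w => by rw [h, map_zero])
  rw [map_mul] at hw
  exact ⟨(z, w), hz, left_ne_zero_of_mul hw, right_ne_zero_of_mul hw⟩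

/-! ### Kernels of families of matrices -/

variable {ρ σ : Type*} [Fintype σ]

theorem mulVec_mem_polyExt (N : Matrix ρ σ A) (t : ρ) :
    (fun p : X × (σ → K) => (N.map (evalAt A p.1)).mulVec p.2 t) ∈ polyExt A σ := by
  have hsum : (fun p : X × (σ → K) => (N.map (evalAt A p.1)).mulVec p.2 t) =
      ∑ s, ((N t s : X → K) ∘ Prod.fst) * fun p => p.2 s := by
    funext p
    simp [Matrix.mulVec, dotProduct]
  rw [hsum]
  exact Subalgebra.sum_mem _ fun s _ =>
    Subalgebra.mul_mem _ (comp_fst_mem_polyExt (N t s).2) (coord_mem_polyExt s)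

variable [Finite ρ]

theorem exists_mem_forall_rank_le (M : Matrix ρ σ A) (x₀ : X) :
    ∃ u ∈ A, u x₀ ≠ 0 ∧ ∀ x, u x ≠ 0 → (M.map (evalAt A x₀)).rank ≤ (M.map (evalAt A x)).rank := by
  obtain ⟨R, C, hRC⟩ := exists_submatrix_det_ne_zero (M.map (evalAt A x₀)) rfl
  have hdet (x) : ((M.submatrix R C).det : X → K) x = ((M.map (evalAt A x)).submatrix R C).det :=
    (evalAt A x).map_det _
  refine ⟨(M.submatrix R C).det, Subtype.property _, by rwa [hdet], fun x hx => ?_⟩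
  rw [hdet] at hx
  simpa using card_le_rank_of_submatrix_det_ne_zero hx

theorem exists_kernel_family (M : Matrix ρ σ A) (x₀ : X) :
    ∃ D ∈ A, D x₀ ≠ 0 ∧ ∃ N : Matrix σ σ A, ∀ x, D x ≠ 0 →
      (M.map (evalAt A x)).rank = (M.map (evalAt A x₀)).rank → ∀ w,
        (M.map (evalAt A x)).mulVec w = 0 ↔ w ∈ Set.range (N.map (evalAt A x)).mulVec := by
  classical
  obtain ⟨R, C, hRC⟩ := exists_submatrix_det_ne_zero (M.map (evalAt A x₀)) rfl
  have hdet (x) : ((M.submatrix R C).det : X → K) x = ((M.map (evalAt A x)).submatrix R C).det :=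
    (evalAt A x).map_det _
  refine ⟨(M.submatrix R C).det, Subtype.property _, by rwa [hdet], cramerKernel M R C,
    fun x hx hr w => ?_⟩
  rw [hdet] at hx
  rw [map_cramerKernel]
  constructor
  · intro hw
    refine ⟨((M.map (evalAt A x)).submatrix R C).det⁻¹ • w, ?_⟩
    rw [Matrix.mulVec_smul, cramerKernel_mulVec R C hw, inv_smul_smul₀ hx]
  · rintro ⟨v, rfl⟩
    rw [Matrix.mulVec_mulVec, mul_cramerKernel hx (by rw [hr, Fintype.card_fin]),
      Matrix.zero_mulVec]

theorem IsPreirreducibleFor.kernels [Infinite K] (hS : IsPreirreducibleFor A S)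
    (M : Matrix ρ σ A)
    (hr : ∀ x ∈ S, ∀ y ∈ S, (M.map (evalAt A x)).rank = (M.map (evalAt A y)).rank) :
    IsPreirreducibleFor (polyExt A σ) {p | p.1 ∈ S ∧ (M.map (evalAt A p.1)).mulVec p.2 = 0} := by
  choose D hD hD₀ N hN using exists_kernel_family M
  refine isPreirreducibleFor_of_cover (u := fun x₀ : S => D x₀ ∘ Prod.fst)
    (fun x₀ => comp_fst_mem_polyExt (hD x₀)) (fun p hp => ⟨⟨p.1, hp.1⟩, hD₀ p.1⟩) ?_ fun x₀ => ?_
  · -- The loci where the kernels are parametrized meet along the zero section.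
    intro x y
    obtain ⟨z, hz, h⟩ := hS _ (hD x) _ (hD y) ⟨x, x.2, hD₀ x⟩ ⟨y, y.2, hD₀ y⟩
    exact ⟨(z, 0), ⟨hz, Matrix.mulVec_zero _⟩, h⟩
  · let T : Set (X × (σ → K)) := {p | p.1 ∈ {x ∈ S | D x₀ x ≠ 0}}
    let φ : T → X × (σ → K) := fun p => (p.1.1, ((N x₀).map (evalAt A p.1.1)).mulVec p.1.2)
    have hφ : ∀ b ∈ polyExt A σ, b ∘ φ ∈ regularOn (polyExt A σ) T := fun b hb =>
      comp_mem_of_mem_polyExt (φ := φ)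
        (fun a ha => restrict_mem_regularOn (comp_fst_mem_polyExt ha))
        (fun t => restrict_mem_regularOn (mulVec_mem_polyExt (N x₀) t)) hb
    convert (hS.inter_ne_zero (hD x₀)).prod.range hφ using 1
    ext ⟨x, w⟩
    constructor
    · rintro ⟨⟨hx, hw⟩, hDx⟩
      obtain ⟨v, rfl⟩ := (hN x₀ x hDx (hr x hx x₀ x₀.2) w).1 hw
      exact ⟨⟨(x, v), hx, hDx⟩, rfl⟩
    · rintro ⟨⟨⟨y, v⟩, hx, hDx⟩, h⟩
      obtain ⟨rfl, rfl⟩ := Prod.mk.inj h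
      exact ⟨⟨hx, (hN x₀ y hDx (hr y hx x₀ x₀.2) _).2 ⟨v, rfl⟩⟩, hDx⟩

theorem IsPreirreducibleFor.kernels_comp [Infinite K] [Finite τ] (hS : IsPreirreducibleFor A S)
    (M : Matrix ρ σ A)
    (hr : ∀ x ∈ S, ∀ y ∈ S, (M.map (evalAt A x)).rank = (M.map (evalAt A y)).rank)
    {ι : σ → τ} (hι : Function.Injective ι) :
    IsPreirreducibleFor (polyExt A τ)
      {p | p.1 ∈ S ∧ (M.map (evalAt A p.1)).mulVec (p.2 ∘ ι) = 0} := by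
  classical
  cases nonempty_fintype τ
  have hsel (w : τ → K) : ((1 : Matrix τ τ K).submatrix ι id).mulVec w = w ∘ ι :=
    funext fun s => congrFun (Matrix.one_mulVec w) (ι s)
  have hmap (x) : (M * (1 : Matrix τ τ A).submatrix ι id).map (evalAt A x) =
      M.map (evalAt A x) * (1 : Matrix τ τ K).submatrix ι id := by
    rw [Matrix.map_mul, ← Matrix.submatrix_map, Matrix.map_one _ (map_zero _) (map_one _)]
  have hrank (x) : ((M * (1 : Matrix τ τ A).submatrix ι id).map (evalAt A x)).rank =
      (M.map (evalAt A x)).rank := by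
    have hsurj : LinearMap.range ((1 : Matrix τ τ K).submatrix ι id).mulVecLin = ⊤ := by
      refine LinearMap.range_eq_top.2 fun v => ?_
      obtain ⟨w, rfl⟩ := hι.surjective_comp_right v
      exact ⟨w, hsel w⟩
    rw [hmap, Matrix.rank, Matrix.mulVecLin_mul, LinearMap.range_comp_of_range_eq_top _ hsurj,
      Matrix.rank]
  simpa only [hmap, ← Matrix.mulVec_mulVec, hsel] using
    hS.kernels (M * (1 : Matrix τ τ A).submatrix ι id)
      (fun x hx y hy => by rw [hrank, hrank, hr x hx y hy])

end RegularFunctions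

/-! ### Topologies defined by rings of functions -/

section Topology

open TopologicalSpace

variable {k K : Type*} [CommRing k] [Field K] [Algebra k K] {X Y Z : Type*} [TopologicalSpace X]
  [TopologicalSpace Y] {A : Subalgebra k (X → K)} {B : Subalgebra k (Y → K)}

theorem isPreirreducibleFor_of_isPreirreducible (hA : ∀ a ∈ A, IsOpen (Function.support a))
    {S : Set X} (hS : IsPreirreducible S) : IsPreirreducibleFor A S :=
  fun a ha b hb => hS _ _ (hA a ha) (hA b hb)

theorem IsPreirreducibleFor.isPreirreducible_range_prodMk {C : Subalgebra k (Z → K)}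
    (hC : IsPreirreducibleFor C Set.univ)
    (hA : IsTopologicalBasis (Function.support '' (A : Set (X → K))))
    (hB : IsTopologicalBasis (Function.support '' (B : Set (Y → K)))) {φ : Z → X} {ψ : Z → Y}
    (hφ : ∀ a ∈ A, a ∘ φ ∈ C) (hψ : ∀ b ∈ B, b ∘ ψ ∈ C) :
    IsPreirreducible (Set.range fun z => (φ z, ψ z)) := by
  have key : ∀ z, ∀ U : Set (X × Y), IsOpen U → (φ z, ψ z) ∈ U →
      ∃ c ∈ C, c z ≠ 0 ∧ ∀ y, c y ≠ 0 → (φ y, ψ y) ∈ U := by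
    intro z U hU hz
    obtain ⟨V, W, hV, hW, hzV, hzW, hVW⟩ := isOpen_prod_iff.1 hU _ _ hz
    obtain ⟨_, ⟨a, ha, rfl⟩, haz, haV⟩ := hA.exists_subset_of_mem_open hzV hV
    obtain ⟨_, ⟨b, hb, rfl⟩, hbz, hbW⟩ := hB.exists_subset_of_mem_open hzW hW
    exact ⟨a ∘ φ * b ∘ ψ, C.mul_mem (hφ a ha) (hψ b hb), mul_ne_zero haz hbz, fun y hy =>
      hVW ⟨haV (left_ne_zero_of_mul hy), hbW (right_ne_zero_of_mul hy)⟩⟩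
  rintro U V hU hV ⟨_, ⟨x, rfl⟩, hx⟩ ⟨_, ⟨y, rfl⟩, hy⟩
  obtain ⟨a, ha, hax, haU⟩ := key x U hU hx
  obtain ⟨b, hb, hby, hbV⟩ := key y V hV hy
  obtain ⟨z, -, haz, hbz⟩ := hC a ha b hb ⟨x, trivial, hax⟩ ⟨y, trivial, hby⟩
  exact ⟨_, ⟨z, rfl⟩, haU z haz, hbV z hbz⟩

theorem upperSemicontinuous_finrank_ker {ρ σ : Type*} [Finite ρ] [Fintype σ]
    (hA : ∀ a ∈ A, IsOpen (Function.support a)) (M : Matrix ρ σ A) :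
    UpperSemicontinuous fun x =>
      Module.finrank K (LinearMap.ker (M.map (evalAt A x)).mulVecLin) := by
  intro x c hc
  obtain ⟨u, hu, hux, hrank⟩ := exists_mem_forall_rank_le M x
  filter_upwards [(hA u hu).mem_nhds hux] with y hy
  have hx := rank_add_finrank_ker (M.map (evalAt A x))
  have hxy := rank_add_finrank_ker (M.map (evalAt A y))
  have hle := hrank y hy
  lia

end Topology

/-! ### Loci of minimality -/

section MinLocus

variable {X : Type*} {g : X → ℕ} {S : Set X} {x : X}

theorem mem_minLocus_iff : x ∈ minLocus g S ↔ x ∈ S ∧ g x = sInf (g '' S) := by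
  refine and_congr_right fun hx => ⟨fun h => ?_, fun h y hy => h ▸ Nat.sInf_le ⟨y, hy, rfl⟩⟩
  exact le_antisymm (le_csInf ⟨_, x, hx, rfl⟩ (by rintro _ ⟨y, hy, rfl⟩; exact h y hy))
    (Nat.sInf_le ⟨x, hx, rfl⟩)

theorem minLocus_nonempty (hS : S.Nonempty) : (minLocus g S).Nonempty := by
  obtain ⟨x, hx, h⟩ := Nat.sInf_mem (hS.image g)
  exact ⟨x, mem_minLocus_iff.2 ⟨hx, h⟩⟩

variable [TopologicalSpace X]

theorem exists_isOpen_minLocus_eq (hg : UpperSemicontinuous g) (S : Set X) :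
    ∃ U, IsOpen U ∧ minLocus g S = S ∩ U := by
  refine ⟨g ⁻¹' Set.Iio (sInf (g '' S) + 1), hg.isOpen_preimage _, Set.ext fun x => ?_⟩
  rw [mem_minLocus_iff]
  refine and_congr_right fun hx => ?_
  have : sInf (g '' S) ≤ g x := Nat.sInf_le ⟨x, hx, rfl⟩
  rw [Set.mem_preimage, Set.mem_Iio]
  lia

theorem sInf_image_closure (hg : UpperSemicontinuous g) (hS : S.Nonempty) :
    sInf (g '' closure S) = sInf (g '' S) := by
  refine le_antisymm
    (Nat.sInf_le (Set.image_mono subset_closure (Nat.sInf_mem (hS.image g)))) ?_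
  obtain ⟨x, hx, hmin⟩ := Nat.sInf_mem (hS.closure.image g)
  obtain ⟨y, hy, hyS⟩ := mem_closure_iff.1 hx _ (hg.isOpen_preimage (g x + 1)) (Nat.lt_succ_self _)
  rw [← hmin]
  exact (Nat.sInf_le (Set.mem_image_of_mem g hyS)).trans (Nat.lt_succ_iff.1 hy)

theorem closure_minLocus (hg : UpperSemicontinuous g) (hS : IsIrreducible S) (hc : IsClosed S) :
    closure (minLocus g S) = S := by
  obtain ⟨U, hU, hSU⟩ := exists_isOpen_minLocus_eq hg S
  rw [hSU]
  exact (closure_minimal Set.inter_subset_left hc).antisymm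
    (subset_closure_inter_of_isPreirreducible_of_isOpen hS.2 hU
      (hSU ▸ minLocus_nonempty hS.1))

end MinLocus

/-! ### Regular functions on the representation varieties -/

section RegularEC

variable {d : ℕ} {m : Fin d → ℕ} {k K : Type*} [Field k] [Field K] [Algebra k K]
  {ν : Vertex m → ℕ}

variable (k K ν) in
/-- The ring of regular functions on `E_C(ν)`: the polynomials over `k` in the matrix entries. -/
def regEC : Subalgebra k (EC k K ν → K) :=
  Algebra.adjoin k (Set.range fun (c : Entry ν) (f : EC k K ν) => Rep.entries f.1 c)

theorem mem_regEC_iff {a : EC k K ν → K} :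
    a ∈ regEC k K ν ↔ ∃ p : MvPolynomial (Entry ν) k,
      ∀ f, a f = MvPolynomial.aeval (Rep.entries f.1) p := by
  rw [regEC, Algebra.adjoin_range_eq_range_aeval]
  have heval (p : MvPolynomial (Entry ν) k) (f : EC k K ν) :
      MvPolynomial.aeval (fun c (f : EC k K ν) => Rep.entries f.1 c) p f =
        MvPolynomial.aeval (Rep.entries f.1) p :=
    DFunLike.congr_fun (MvPolynomial.comp_aeval _ (Pi.evalAlgHom k (fun _ : EC k K ν => K) f)) p
  constructor
  · rintro ⟨p, rfl⟩
    exact ⟨p, heval p⟩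
  · rintro ⟨p, hp⟩
    exact ⟨p, funext fun f => (heval p f).trans (hp f).symm⟩

theorem isTopologicalBasis_support_regEC : TopologicalSpace.IsTopologicalBasis
    (Function.support '' (regEC k K ν : Set (EC k K ν → K))) := by
  refine TopologicalSpace.isTopologicalBasis_of_isOpen_of_nhds ?_ ?_
  · rintro _ ⟨a, ha, rfl⟩
    obtain ⟨p, hp⟩ := mem_regEC_iff.1 ha
    refine ⟨(MvPolynomial.zeroLocus K (Ideal.span {p}))ᶜ, ⟨⟨_, (compl_compl _).symm⟩, ?_⟩⟩
    ext f
    simp [MvPolynomial.zeroLocus_span, hp f]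
  · rintro f _ hf ⟨V, ⟨I, hI⟩, rfl⟩
    obtain ⟨p, hpI, hp⟩ : ∃ p ∈ I, MvPolynomial.aeval (Rep.entries f.1) p ≠ 0 := by
      have hfI : Rep.entries f.1 ∉ MvPolynomial.zeroLocus K I := hI ▸ fun h => h hf
      simpa only [MvPolynomial.mem_zeroLocus_iff, not_forall, exists_prop] using hfI
    refine ⟨_, ⟨_, mem_regEC_iff.2 ⟨p, fun _ => rfl⟩, rfl⟩, hp, fun g hg => ?_⟩
    by_contra hgV
    have hgI : Rep.entries g.1 ∈ MvPolynomial.zeroLocus K I := hI ▸ hgV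
    exact hg (hgI p hpI)

theorem isOpen_support_of_mem_regEC {a : EC k K ν → K} (ha : a ∈ regEC k K ν) :
    IsOpen (Function.support a) :=
  isTopologicalBasis_support_regEC.isOpen ⟨a, ha, rfl⟩

theorem comp_mem_of_forall_toMatrix_mem {Z : Type*} {C : Subalgebra k (Z → K)} {φ : Z → EC k K ν}
    (hφ : ∀ ⦃i j⦄ (τ : i ⟶ j) r s, (fun z => LinearMap.toMatrix' ((φ z).1 τ) r s) ∈ C)
    {a : EC k K ν → K} (ha : a ∈ regEC k K ν) : a ∘ φ ∈ C := by
  induction ha using Algebra.adjoin_induction with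
  | mem a ha =>
    obtain ⟨c, rfl⟩ := ha
    exact hφ c.1.2.2 c.2.1 c.2.2
  | algebraMap c => exact C.algebraMap_mem c
  | add a b _ _ ha hb => exact C.add_mem ha hb
  | mul a b _ _ ha hb => exact C.mul_mem ha hb

variable (k K ν) in
/-- The matrix of `f_τ`, as a matrix of regular functions of `f`. -/
def genericMatrix {i j : Vertex m} (τ : i ⟶ j) :
    Matrix (Fin (ν j)) (Fin (ν i)) (regEC k K ν) :=
  fun r s => ⟨fun f => LinearMap.toMatrix' (f.1 τ) r s,
    Algebra.subset_adjoin ⟨⟨⟨i, j, τ⟩, r, s⟩, rfl⟩⟩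

instance (i j : Vertex m) : Subsingleton (i ⟶ j) := inferInstanceAs (Subsingleton (PLift _))

instance (i : Vertex m) : Fintype (Σ j : Vertex m, (i ⟶ j)) := Fintype.ofFinite _

variable (k K ν) in
/-- The matrix of `(f_τ)_{s(τ) = i}`, as a matrix of regular functions of `f`. -/
def epsMatrix (i : Vertex m) :
    Matrix (Σ τ : (Σ j : Vertex m, (i ⟶ j)), Fin (ν τ.1)) (Fin (ν i)) (regEC k K ν) :=
  fun a => genericMatrix k K ν a.1.2 a.2

theorem epsMatrix_mulVec_eq_zero_iff {i : Vertex m} {f : EC k K ν} {v : Fin (ν i) → K} :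
    ((epsMatrix k K ν i).map (evalAt _ f)).mulVec v = 0 ↔
      ∀ (j : Vertex m) (τ : i ⟶ j), f.1 τ v = 0 := by
  have hrow (a) : ((epsMatrix k K ν i).map (evalAt _ f)).mulVec v a = f.1 a.1.2 v a.2 :=
    congrFun (LinearMap.toMatrix'_mulVec (f.1 a.1.2) v) a.2
  simp only [funext_iff, hrow, Sigma.forall, Pi.zero_apply]

theorem epsStarPt_eq (i : Vertex m) (f : EC k K ν) : epsStarPt i f =
    Module.finrank K (LinearMap.ker ((epsMatrix k K ν i).map (evalAt _ f)).mulVecLin) := by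
  have hker : LinearMap.ker (LinearMap.pi (fun τ : (Σ j : Vertex m, (i ⟶ j)) => f.1 τ.2)) =
      LinearMap.ker ((epsMatrix k K ν i).map (evalAt _ f)).mulVecLin := by
    ext v
    rw [LinearMap.mem_ker, LinearMap.mem_ker, Matrix.mulVecLin_apply, epsMatrix_mulVec_eq_zero_iff]
    simp only [funext_iff, LinearMap.pi_apply, Sigma.forall, Pi.zero_apply]
  rw [epsStarPt, hker]

theorem upperSemicontinuous_epsStarPt (i : Vertex m) :
    UpperSemicontinuous (epsStarPt i : EC k K ν → ℕ) := by
  simpa only [← epsStarPt_eq] using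
    upperSemicontinuous_finrank_ker (fun _ => isOpen_support_of_mem_regEC) (epsMatrix k K ν i)

open Classical in
variable (k K ν) in
/-- The matrix of the component `K^{ν_j} → K^{ν_l}` of `F_i(f)`, as a matrix of regular functions
of `f`. -/
def genericFStarComp (i j l : Vertex m) : Matrix (Fin (ν l)) (Fin (ν j)) (regEC k K ν) :=
  if h : IsArrow l j ∧ ∃ j' ∈ in1 i, LexLT j j' ∧ IsArrow l j' then
    (genericMatrix k K ν (PLift.up h.1)).transpose
  else if h : IsArrow l j ∧ ∃ j' ∈ in1 i, LexLT j' j ∧ IsArrow l j' then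
    -(genericMatrix k K ν (PLift.up h.1)).transpose
  else 0

theorem map_genericFStarComp (i j l : Vertex m) (f : EC k K ν) :
    (genericFStarComp k K ν i j l).map (evalAt _ f) = LinearMap.toMatrix' (FStarComp i f j l) := by
  unfold genericFStarComp FStarComp transposeMap
  split_ifs
  · rw [LinearMap.toMatrix'_toLin']; rfl
  · rw [map_neg, LinearMap.toMatrix'_toLin']; rfl
  · rw [map_zero]; exact Matrix.map_zero _ (map_zero _)

variable (k K ν) in
/-- The matrix of `F_i(f)`, as a matrix of regular functions of `f`. -/
def fStarMatrix (i : Vertex m) :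
    Matrix (Σ l : in2 i, Fin (ν l)) (Σ j : in1 i, Fin (ν j)) (regEC k K ν) :=
  fun a b => genericFStarComp k K ν i b.1 a.1 a.2 b.2

open Classical in
instance (i : Vertex m) : Fintype (in1 i) := inferInstance

open Classical in
instance (i : Vertex m) : Fintype (in2 i) := inferInstance

theorem fStarMatrix_mulVec (i : Vertex m) (f : EC k K ν) (w : (Σ j : in1 i, Fin (ν j)) → K)
    (a : Σ l : in2 i, Fin (ν l)) :
    ((fStarMatrix k K ν i).map (evalAt _ f)).mulVec w a =
      FStar i f (fun j c => w ⟨j, c⟩) a.1 a.2 := by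
  have hcol (j : in1 i) : FStarComp i f j a.1 (fun c => w ⟨j, c⟩) a.2 =
      ∑ c, evalAt _ f (genericFStarComp k K ν i j a.1 a.2 c) * w ⟨j, c⟩ := by
    rw [← LinearMap.toMatrix'_mulVec, ← map_genericFStarComp]; rfl
  simp only [FStar, LinearMap.pi_apply, LinearMap.sum_apply, LinearMap.comp_apply,
    LinearMap.proj_apply, Finset.sum_apply, hcol]
  exact Fintype.sum_sigma _

theorem fStarMatrix_mulVec_eq_zero_iff {i : Vertex m} {f : EC k K ν}
    {w : (Σ j : in1 i, Fin (ν j)) → K} :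
    ((fStarMatrix k K ν i).map (evalAt _ f)).mulVec w = 0 ↔
      FStar i f (fun j c => w ⟨j, c⟩) = 0 := by
  simp only [funext_iff, fStarMatrix_mulVec, Sigma.forall, Pi.zero_apply]

theorem finrank_extStar_eq (i : Vertex m) (f : EC k K ν) : Module.finrank K (ExtStar i f) =
    Module.finrank K (LinearMap.ker ((fStarMatrix k K ν i).map (evalAt _ f)).mulVecLin) := by
  have hker : (LinearMap.ker (FStar i f)).comap
      (LinearEquiv.piCurry K (fun (j : in1 i) (_ : Fin (ν j)) => K) : _ →ₗ[K] _) =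
        LinearMap.ker ((fStarMatrix k K ν i).map (evalAt _ f)).mulVecLin :=
    Submodule.ext fun w => fStarMatrix_mulVec_eq_zero_iff.symm
  rw [Subspace.dual_finrank_eq, ← hker]
  exact (LinearEquiv.ofSubmodule' (LinearEquiv.piCurry K _)
    (LinearMap.ker (FStar i f))).finrank_eq.symm

theorem upperSemicontinuous_finrank_extStar (i : Vertex m) :
    UpperSemicontinuous fun f : EC k K ν => Module.finrank K (ExtStar i f) := by
  simpa only [← finrank_extStar_eq] using
    upperSemicontinuous_finrank_ker (fun _ => isOpen_support_of_mem_regEC) (fStarMatrix k K ν i)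

end RegularEC

/-! ### Surjections of vector spaces -/

section LinearAlgebra

variable {K V W : Type*} [Field K] [AddCommGroup V] [Module K V] [AddCommGroup W] [Module K W]

theorem finrank_add_finrank_ker_of_surjective [FiniteDimensional K V] {φ : V →ₗ[K] W}
    (hφ : Function.Surjective φ) :
    Module.finrank K W + Module.finrank K (LinearMap.ker φ) = Module.finrank K V := by
  rw [← φ.finrank_range_add_finrank_ker, LinearMap.range_eq_top.2 hφ, finrank_top]

theorem exists_linearEquiv_comp_eq [FiniteDimensional K V] {φ ψ : V →ₗ[K] W}
    (hφ : Function.Surjective φ) (hψ : Function.Surjective ψ) :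
    ∃ e : V ≃ₗ[K] V, φ ∘ₗ e.toLinearMap = ψ := by
  obtain ⟨s, hs⟩ := φ.exists_rightInverse_of_surjective (LinearMap.range_eq_top.2 hφ)
  obtain ⟨t, ht⟩ := ψ.exists_rightInverse_of_surjective (LinearMap.range_eq_top.2 hψ)
  let κ : LinearMap.ker ψ ≃ₗ[K] LinearMap.ker φ := LinearEquiv.ofFinrankEq _ _
    (Nat.add_left_cancel ((finrank_add_finrank_ker_of_surjective hψ).trans
      (finrank_add_finrank_ker_of_surjective hφ).symm))
  let π : V →ₗ[K] LinearMap.ker ψ := LinearMap.codRestrict _ (LinearMap.id - t ∘ₗ ψ) fun v => by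
    simpa [sub_eq_zero] using (LinearMap.congr_fun ht (ψ v)).symm
  let e : V →ₗ[K] V := s ∘ₗ ψ + (LinearMap.ker φ).subtype ∘ₗ κ.toLinearMap ∘ₗ π
  have he : φ ∘ₗ e = ψ := by
    rw [LinearMap.comp_add, ← LinearMap.comp_assoc, hs, ← LinearMap.comp_assoc,
      LinearMap.comp_ker_subtype, LinearMap.zero_comp, add_zero, LinearMap.id_comp]
  have hinj : Function.Injective e := by
    refine (injective_iff_map_eq_zero e).2 fun v hv => ?_
    have hψv : ψ v = 0 := by rw [← he, LinearMap.comp_apply, hv, map_zero]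
    have hπv : π v = 0 := by simpa [e, hψv] using hv
    simpa [π, hψv] using congrArg Subtype.val hπv
  exact ⟨LinearEquiv.ofInjectiveEndo e hinj, he⟩

theorem exists_surjective_ker_eq [FiniteDimensional K V] (U : Submodule K V) {q : ℕ}
    (hq : Module.finrank K U + q = Module.finrank K V) :
    ∃ φ : V →ₗ[K] (Fin q → K), Function.Surjective φ ∧ LinearMap.ker φ = U := by
  have hquot : Module.finrank K (V ⧸ U) = Module.finrank K (Fin q → K) := by
    have := U.finrank_quotient_add_finrank
    rw [Module.finrank_fin_fun]
    lia
  let e := LinearEquiv.ofFinrankEq _ _ hquot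
  exact ⟨e.toLinearMap ∘ₗ U.mkQ, e.surjective.comp U.mkQ_surjective, by
    rw [LinearEquiv.ker_comp, U.ker_mkQ]⟩

theorem finrank_comap_of_surjective [FiniteDimensional K V] {φ : V →ₗ[K] W}
    (hφ : Function.Surjective φ) (U : Submodule K W) :
    Module.finrank K (U.comap φ) = Module.finrank K U + Module.finrank K (LinearMap.ker φ) := by
  have hcomap : U.comap φ = LinearMap.ker (U.mkQ ∘ₗ φ) := by rw [LinearMap.ker_comp, U.ker_mkQ]
  have : FiniteDimensional K W := Module.Finite.of_surjective φ hφ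
  have h₁ := finrank_add_finrank_ker_of_surjective hφ
  have h₂ := finrank_add_finrank_ker_of_surjective (φ := U.mkQ ∘ₗ φ) (U.mkQ_surjective.comp hφ)
  have h₃ := U.finrank_quotient_add_finrank
  rw [hcomap]
  lia

end LinearAlgebra

/-! ### Quotients of representations -/

section Quotients

variable {d : ℕ} {m : Fin d → ℕ} {k K : Type*} [Field K] {n ν : Vertex m → ℕ}

/-- The linear maps `φ_j` form a morphism of representations `f → f'`. -/
def IsMorphism (f : Rep K n) (f' : Rep K ν) (φ : ∀ j, (Fin (n j) → K) →ₗ[K] (Fin (ν j) → K)) :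
    Prop :=
  ∀ ⦃j l : Vertex m⦄ (τ : j ⟶ l), φ l ∘ₗ f τ = f' τ ∘ₗ φ j

variable {φ : ∀ j, (Fin (n j) → K) →ₗ[K] (Fin (ν j) → K)}

theorem IsMorphism.apply {f : Rep K n} {f' : Rep K ν} (h : IsMorphism f f' φ) {j l : Vertex m}
    (τ : j ⟶ l) (v : Fin (n j) → K) : φ l (f τ v) = f' τ (φ j v) :=
  LinearMap.congr_fun (h τ) v

theorem IsMorphism.eval {f : Rep K n} {f' : Rep K ν} (h : IsMorphism f f' φ) {j l : Vertex m}
    (p : Quiver.Path j l) : φ l ∘ₗ f.eval p = f'.eval p ∘ₗ φ j := by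
  induction p with
  | nil => rfl
  | cons p τ ih =>
    rw [Rep.eval, ← LinearMap.comp_assoc, h τ, LinearMap.comp_assoc, ih, ← LinearMap.comp_assoc,
      Rep.eval]

theorem IsMorphism.commutes {f : Rep K n} {f' : Rep K ν} (h : IsMorphism f f' φ)
    (hφ : ∀ j, Function.Surjective (φ j)) (hf : f.Commutes) : f'.Commutes := by
  intro j l p q
  rw [← LinearMap.cancel_right (hφ j), ← h.eval, ← h.eval, hf j l p q]

theorem IsMorphism.unique {f : Rep K n} {f' g' : Rep K ν} (h : IsMorphism f f' φ)
    (h' : IsMorphism f g' φ) (hφ : ∀ j, Function.Surjective (φ j)) : f' = g' := by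
  funext j l τ
  rw [← LinearMap.cancel_right (hφ j), ← h τ, ← h' τ]

theorem exists_isMorphism (f : EC k K n) (hφ : ∀ j, Function.Surjective (φ j))
    (hker : ∀ ⦃j l⦄ (τ : j ⟶ l) v, φ j v = 0 → φ l (f.1 τ v) = 0) :
    ∃ f' : EC k K ν, IsMorphism f.1 f'.1 φ := by
  choose s hs using fun j => (φ j).exists_rightInverse_of_surjective
    (LinearMap.range_eq_top.2 (hφ j))
  have h : IsMorphism f.1 (fun j l τ => φ l ∘ₗ f.1 τ ∘ₗ s j) φ := by
    intro j l τ
    refine LinearMap.ext fun v => ?_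
    have hv : φ j (v - s j (φ j v)) = 0 := by
      rw [map_sub, sub_eq_zero]
      exact (LinearMap.congr_fun (hs j) (φ j v)).symm
    have := hker τ _ hv
    rwa [map_sub, map_sub, sub_eq_zero] at this
  exact ⟨⟨_, h.commutes hφ f.2⟩, h⟩

/-- The representation `f'` is isomorphic to a quotient of `f`. -/
def HasQuotient (f : EC k K n) (f' : EC k K ν) : Prop :=
  ∃ φ : ∀ j, (Fin (n j) → K) →ₗ[K] (Fin (ν j) → K),
    (∀ j, Function.Surjective (φ j)) ∧ IsMorphism f.1 f'.1 φ

theorem exists_extPoint_iff_hasQuotient {a : Vertex m → ℕ} (hn : ∀ j, n j = ν j + a j)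
    {f : EC k K n} {f' : EC k K ν} :
    (∃ x : ExtPoint K a ν n, varpi4 k x = f ∧ varpi3 k x = f') ↔ HasQuotient f f' := by
  constructor
  · rintro ⟨x, rfl, rfl⟩
    exact ⟨x.quot, x.surjective, fun j l τ => (x.quotRep_comp τ).symm⟩
  · rintro ⟨φ, hφ, h⟩
    have hfinrank (j) : Module.finrank K (Fin (a j) → K) =
        Module.finrank K (LinearMap.ker (φ j)) := by
      have h₁ := finrank_add_finrank_ker_of_surjective (hφ j)
      have h₂ := hn j
      rw [Module.finrank_fin_fun, Module.finrank_fin_fun] at h₁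
      rw [Module.finrank_fin_fun]
      lia
    let ι (j) : (Fin (a j) → K) →ₗ[K] (Fin (n j) → K) :=
      (LinearMap.ker (φ j)).subtype ∘ₗ (LinearEquiv.ofFinrankEq _ _ (hfinrank j)).toLinearMap
    have hι (j) : LinearMap.range (ι j) = LinearMap.ker (φ j) := by
      rw [LinearMap.range_comp_of_range_eq_top _ (LinearEquiv.range _), Submodule.range_subtype]
    let x : ExtPoint K a ν n :=
      { sub := ι
        quot := φ
        rep := f.1
        injective := fun j => Subtype.val_injective.comp (LinearEquiv.injective _)
        exact := fun j => LinearMap.exact_iff.2 (hι j).symm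
        surjective := hφ
        commutes := f.2
        stable := fun j l τ => by
          rw [hι, LinearMap.range_comp, hι, Submodule.map_le_iff_le_comap]
          intro v hv
          rw [Submodule.mem_comap, LinearMap.mem_ker, h.apply, LinearMap.mem_ker.1 hv, map_zero] }
    refine ⟨x, rfl, Subtype.ext (IsMorphism.unique (φ := φ) (f := f.1) ?_ h hφ)⟩
    exact fun j l τ => (x.quotRep_comp τ).symm

/-! ### Quotients by a simple subrepresentation -/

theorem ne_of_hom {j l : Vertex m} (τ : j ⟶ l) : j ≠ l := by
  rintro rfl
  obtain ⟨x, hx, -⟩ := τ.down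
  exact Nat.succ_ne_self _ hx

variable {b : Vertex m → ℕ} {i : Vertex m}

theorem injective_of_surjective_of_ne
    {φ : ∀ j, (Fin ((b + simpleDim i) j) → K) →ₗ[K] (Fin (b j) → K)}
    (hφ : ∀ j, Function.Surjective (φ j)) {j : Vertex m} (hj : j ≠ i) :
    Function.Injective (φ j) := by
  refine (LinearMap.injective_iff_surjective_of_finrank_eq_finrank ?_).2 (hφ j)
  simp [hj]

theorem finrank_ker_of_surjective
    {φ : ∀ j, (Fin ((b + simpleDim i) j) → K) →ₗ[K] (Fin (b j) → K)}
    (hφ : ∀ j, Function.Surjective (φ j)) : Module.finrank K (LinearMap.ker (φ i)) = 1 := by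
  have h₁ := finrank_add_finrank_ker_of_surjective (hφ i)
  have h₂ : (b + simpleDim i) i = b i + 1 := by simp
  rw [Module.finrank_fin_fun, Module.finrank_fin_fun] at h₁
  lia

theorem IsMorphism.apply_eq_zero_iff {f : Rep K (b + simpleDim i)} {f' : Rep K b}
    {φ : ∀ j, (Fin ((b + simpleDim i) j) → K) →ₗ[K] (Fin (b j) → K)} (h : IsMorphism f f' φ)
    (hφ : ∀ j, Function.Surjective (φ j)) {j : Vertex m} (τ : i ⟶ j)
    (v : Fin ((b + simpleDim i) i) → K) : f τ v = 0 ↔ f' τ (φ i v) = 0 := by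
  rw [← h.apply, map_eq_zero_iff _ (injective_of_surjective_of_ne hφ (ne_of_hom τ).symm)]

theorem HasQuotient.epsStarPt_eq {f : EC k K (b + simpleDim i)} {f' : EC k K b}
    (h : HasQuotient f f') : epsStarPt i f = epsStarPt i f' + 1 := by
  obtain ⟨φ, hφ, h⟩ := h
  have hker : LinearMap.ker (LinearMap.pi fun τ : (Σ j : Vertex m, (i ⟶ j)) => f.1 τ.2) =
      (LinearMap.ker (LinearMap.pi fun τ : (Σ j : Vertex m, (i ⟶ j)) => f'.1 τ.2)).comap (φ i) := by
    ext v
    rw [Submodule.mem_comap, LinearMap.mem_ker, LinearMap.mem_ker, funext_iff, funext_iff]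
    exact forall_congr' fun τ => h.apply_eq_zero_iff hφ τ.2 v
  rw [epsStarPt, hker, finrank_comap_of_surjective (hφ i), finrank_ker_of_surjective hφ, epsStarPt]

theorem exists_quotient {f : EC k K (b + simpleDim i)} (hf : 0 < epsStarPt i f) :
    ∃ f' : EC k K b, HasQuotient f f' := by
  have : Nontrivial (LinearMap.ker
      (LinearMap.pi fun τ : (Σ j : Vertex m, (i ⟶ j)) => f.1 τ.2)) := Module.finrank_pos_iff.1 hf
  obtain ⟨⟨v, hv⟩, hv0⟩ := exists_ne (0 : LinearMap.ker
    (LinearMap.pi fun τ : (Σ j : Vertex m, (i ⟶ j)) => f.1 τ.2))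
  have hv0 : v ≠ 0 := fun h => hv0 (Subtype.ext h)
  have hφ (j) : ∃ φ : (Fin ((b + simpleDim i) j) → K) →ₗ[K] (Fin (b j) → K),
      Function.Surjective φ ∧ ∀ w, φ w = 0 → ∀ l (τ : j ⟶ l), f.1 τ w = 0 := by
    rcases eq_or_ne j i with rfl | hj
    · obtain ⟨φ, hφ, hker⟩ := exists_surjective_ker_eq (K ∙ v) (q := b j)
        (by rw [finrank_span_singleton hv0, Module.finrank_fin_fun]; simp [add_comm])
      refine ⟨φ, hφ, fun w hw l τ => ?_⟩
      obtain ⟨c, rfl⟩ := Submodule.mem_span_singleton.1 (hker.le hw)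
      rw [map_smul, show f.1 τ v = 0 from congrFun hv ⟨l, τ⟩, smul_zero]
    · obtain ⟨φ, hφ, hker⟩ := exists_surjective_ker_eq
        (⊥ : Submodule K (Fin ((b + simpleDim i) j) → K)) (q := b j) (by simp [hj])
      refine ⟨φ, hφ, fun w hw l τ => ?_⟩
      rw [(Submodule.mem_bot K).1 (hker.le hw), map_zero]
  choose φ hφ hker using hφ
  obtain ⟨f', h⟩ := exists_isMorphism (ν := b) f hφ
    fun j l τ v hv => by rw [hker j v hv l τ, map_zero]
  exact ⟨f', φ, hφ, h⟩

end Quotients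

/-! ### Order theory of the grid -/

section Grid

variable {d : ℕ} {m : Fin d → ℕ} {i j l : Vertex m}

instance : DistribLattice (Vertex m) := inferInstanceAs (DistribLattice (∀ l, Fin (m l)))

instance : LocallyFiniteOrder (Vertex m) := inferInstanceAs (LocallyFiniteOrder (∀ l, Fin (m l)))

theorem isArrow_iff_covBy : IsArrow i j ↔ i ⋖ j := by
  rw [show i ⋖ j ↔ ∃ l, i l ⋖ j l ∧ ∀ k ≠ l, i k = j k from Pi.covBy_iff]
  refine exists_congr fun l => and_congr_left fun _ => ?_
  rw [Fin.covBy_iff, Nat.covBy_iff_add_one_eq]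

theorem nonempty_path_iff_le : Nonempty (Quiver.Path i j) ↔ i ≤ j := by
  rw [le_iff_reflTransGen_covBy]
  constructor
  · rintro ⟨p⟩
    induction p with
    | nil => exact .refl
    | cons _ τ ih => exact ih.tail (isArrow_iff_covBy.1 τ.down)
  · intro h
    induction h with
    | refl => exact ⟨.nil⟩
    | tail _ hjl ih => exact ih.map fun p => p.cons ⟨isArrow_iff_covBy.2 hjl⟩

theorem le_of_path (p : Quiver.Path i j) : i ≤ j := nonempty_path_iff_le.1 ⟨p⟩

theorem isEmpty_path_of_hom (τ : j ⟶ i) : IsEmpty (Quiver.Path i j) :=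
  ⟨fun p => (isArrow_iff_covBy.1 τ.down).lt.not_ge (le_of_path p)⟩

theorem exists_square {j' : Vertex m} (τ : j ⟶ i) (τ' : j' ⟶ i) (h : j ≠ j') (hl : l ≤ j)
    (hl' : l ≤ j') : ∃ r, l ≤ r ∧ Nonempty (r ⟶ j) ∧ Nonempty (r ⟶ j') := by
  have hj := isArrow_iff_covBy.1 τ.down
  have hj' := isArrow_iff_covBy.1 τ'.down
  have hsup : j ⊔ j' = i := hj.wcovBy.sup_eq hj'.wcovBy h
  refine ⟨j ⊓ j', le_inf hl hl', ⟨⟨isArrow_iff_covBy.2 ?_⟩⟩, ⟨⟨isArrow_iff_covBy.2 ?_⟩⟩⟩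
  · exact inf_covBy_of_covBy_sup_right (by rwa [hsup])
  · exact inf_covBy_of_covBy_sup_left (by rwa [hsup])

theorem eq_or_eq_of_square {j₁ j₂ : Vertex m} (h₁ : IsArrow j₁ i) (h₂ : IsArrow j₂ i)
    (hne : j₁ ≠ j₂) (hl₁ : IsArrow l j₁) (hl₂ : IsArrow l j₂) (hj : IsArrow j i)
    (hl : IsArrow l j) : j = j₁ ∨ j = j₂ := by
  rw [isArrow_iff_covBy] at h₁ h₂ hl₁ hl₂ hj hl
  by_contra! h
  have hsup : j₁ ⊔ j₂ = i := h₁.wcovBy.sup_eq h₂.wcovBy hne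
  have hinf {j' : Vertex m} (hl' : l ⋖ j') (hjj' : j ≠ j') : j ⊓ j' = l :=
    hl.wcovBy.inf_eq hl'.wcovBy hjj'
  have := inf_sup_left j j₁ j₂
  rw [hsup, inf_eq_left.2 hj.le, hinf hl₁ h.1, hinf hl₂ h.2, sup_idem] at this
  exact hl.ne' this

end Grid

section Squares

variable {d : ℕ} {m : Fin d → ℕ} {K : Type*} [Field K] {ν : Vertex m → ℕ} {f : Rep K ν}
  {i : Vertex m}

theorem commutes_of_squares
    (hne : ∀ ⦃j l : Vertex m⦄ (p q : Quiver.Path j l), l ≠ i → f.eval p = f.eval q)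
    (hsq : ∀ ⦃l j j' : Vertex m⦄ (σ : l ⟶ j) (τ : j ⟶ i) (σ' : l ⟶ j') (τ' : j' ⟶ i),
      j ≠ j' → f τ ∘ₗ f σ = f τ' ∘ₗ f σ') : f.Commutes := by
  intro l s p q
  by_cases hs : s = i
  swap
  · exact hne p q hs
  subst hs
  cases p with
  | nil =>
    cases q with
    | nil => rfl
    | cons q τ => exact ((isEmpty_path_of_hom τ).false q).elim
  | @cons j _ p τ =>
    cases q with
    | nil => exact ((isEmpty_path_of_hom τ).false p).elim
    | @cons j' _ q τ' =>
      rcases eq_or_ne j j' with rfl | hjj'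
      · rw [Rep.eval, Rep.eval, Subsingleton.elim τ τ', hne p q (ne_of_hom τ)]
      · obtain ⟨r, hlr, ⟨σ⟩, ⟨σ'⟩⟩ := exists_square τ τ' hjj' (le_of_path p) (le_of_path q)
        obtain ⟨t⟩ := nonempty_path_iff_le.2 hlr
        rw [Rep.eval, Rep.eval, hne p (t.cons σ) (ne_of_hom τ), hne q (t.cons σ') (ne_of_hom τ'),
          Rep.eval, Rep.eval, ← LinearMap.comp_assoc, ← LinearMap.comp_assoc, hsq σ τ σ' τ' hjj']

end Squares

/-! ### The kernel of `F_i` parametrizes extensions -/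

section FStarKernel

variable {d : ℕ} {m : Fin d → ℕ} {k K : Type*} [Field K] {b : Vertex m → ℕ} {i : Vertex m}

/-- The source of an arrow that ends in `i`, as an element of `in₁(i)`. -/
abbrev source {j : Vertex m} (τ : j ⟶ i) : in1 i := ⟨j, τ.down⟩

theorem transposeMap_dotProduct {p q : ℕ} (g : (Fin p → K) →ₗ[K] (Fin q → K)) (w : Fin q → K)
    (v : Fin p → K) : transposeMap g w ⬝ᵥ v = w ⬝ᵥ g v := by
  rw [transposeMap, Matrix.toLin'_apply, Matrix.mulVec_transpose, ← Matrix.dotProduct_mulVec,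
    LinearMap.toMatrix'_mulVec]

theorem transposeMap_eq_iff {p q r : ℕ} {g : (Fin p → K) →ₗ[K] (Fin q → K)}
    {g' : (Fin p → K) →ₗ[K] (Fin r → K)} {w : Fin q → K} {w' : Fin r → K} :
    transposeMap g w = transposeMap g' w' ↔ ∀ v, w ⬝ᵥ g v = w' ⬝ᵥ g' v := by
  simp only [← transposeMap_dotProduct]
  exact dotProduct_eq_iff.symm

theorem lexLT_or_lexLT {j j' : Vertex m} (h : j ≠ j') : LexLT j j' ∨ LexLT j' j :=
  lt_or_gt_of_ne fun h' : @toLex (∀ l, Fin (m l)) j = @toLex (∀ l, Fin (m l)) j' =>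
    h (toLex.injective h')

theorem FStar_apply_of_lexLT (f : EC k K b) (w : (j : in1 i) → Fin (b j) → K)
    {l j j' : Vertex m} (hl : l ∈ in2 i) (σ : l ⟶ j) (τ : j ⟶ i) (σ' : l ⟶ j') (τ' : j' ⟶ i)
    (hlt : LexLT j j') :
    FStar i f w ⟨l, hl⟩ =
      transposeMap (f.1 σ) (w (source τ)) - transposeMap (f.1 σ') (w (source τ')) := by
  have hne : j ≠ j' := by
    rintro rfl
    exact lt_irrefl _ hlt
  have hcases (s) (hs : s ∈ in1 i) (hls : IsArrow l s) : s = j ∨ s = j' :=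
    eq_or_eq_of_square τ.down τ'.down hne σ.down σ'.down hs hls
  have hj : FStarComp i f j l = transposeMap (f.1 σ) := dif_pos ⟨σ.down, j', τ'.down, hlt, σ'.down⟩
  have hj' : FStarComp i f j' l = -transposeMap (f.1 σ') := by
    refine (dif_neg ?_).trans (dif_pos ⟨σ'.down, j, τ.down, hlt, σ.down⟩)
    rintro ⟨-, s, hs, hlt', hls⟩
    rcases hcases s hs hls with rfl | rfl
    · exact lt_asymm hlt hlt'
    · exact lt_irrefl _ hlt'
  have hzero (s : in1 i) (hs : s ≠ source τ ∧ s ≠ source τ') : FStarComp i f s l = 0 := by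
    have hls : ¬IsArrow l s := fun h => (hcases s s.2 h).elim
      (fun h => hs.1 (Subtype.ext h)) fun h => hs.2 (Subtype.ext h)
    rw [FStarComp, dif_neg fun h => hls h.1, dif_neg fun h => hls h.1]
  simp only [FStar, LinearMap.pi_apply, LinearMap.sum_apply, LinearMap.comp_apply,
    LinearMap.proj_apply]
  rw [Fintype.sum_eq_add (source τ) (source τ') (fun h => hne (congrArg Subtype.val h))
    fun s hs => by rw [hzero s hs, LinearMap.zero_apply], hj, hj', LinearMap.neg_apply,
    sub_eq_add_neg]

theorem FStar_eq_zero_iff {f : EC k K b} {w : (j : in1 i) → Fin (b j) → K} :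
    FStar i f w = 0 ↔ ∀ ⦃l j j' : Vertex m⦄ (σ : l ⟶ j) (τ : j ⟶ i) (σ' : l ⟶ j') (τ' : j' ⟶ i),
      j ≠ j' → ∀ v, w (source τ) ⬝ᵥ f.1 σ v = w (source τ') ⬝ᵥ f.1 σ' v := by
  simp only [← transposeMap_eq_iff]
  constructor
  · intro h l j j' σ τ σ' τ' hne
    have hl : l ∈ in2 i := ⟨j, τ.down, j', τ'.down, hne, σ.down, σ'.down⟩
    have h0 : FStar i f w ⟨l, hl⟩ = 0 := congrFun h ⟨l, hl⟩
    rcases lexLT_or_lexLT hne with hlt | hlt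
    · rwa [FStar_apply_of_lexLT f w hl σ τ σ' τ' hlt, sub_eq_zero] at h0
    · rwa [FStar_apply_of_lexLT f w hl σ' τ' σ τ hlt, sub_eq_zero, eq_comm] at h0
  · intro h
    funext ⟨l, hl⟩
    obtain ⟨j, hj, j', hj', hne, hlj, hlj'⟩ := id hl
    rcases lexLT_or_lexLT hne with hlt | hlt
    · rw [FStar_apply_of_lexLT f w hl ⟨hlj⟩ ⟨hj⟩ ⟨hlj'⟩ ⟨hj'⟩ hlt]
      exact sub_eq_zero.2 (h _ ⟨hj⟩ _ ⟨hj'⟩ hne)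
    · rw [FStar_apply_of_lexLT f w hl ⟨hlj'⟩ ⟨hj'⟩ ⟨hlj⟩ ⟨hj⟩ hlt]
      exact sub_eq_zero.2 (h _ ⟨hj'⟩ _ ⟨hj⟩ hne.symm)

end FStarKernel

section StandardExtensions

variable {d : ℕ} {m : Fin d → ℕ} {k K : Type*} [Field K] {b : Vertex m → ℕ} {i : Vertex m}

variable (K b i) in
/-- The projection `K^{b_j + δ_{ij}} → K^{b_j}` that forgets the last coordinate if `j = i`, and the
identity if `j ≠ i`. -/
def trunc (j : Vertex m) : (Fin ((b + simpleDim i) j) → K) →ₗ[K] (Fin (b j) → K) :=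
  LinearMap.funLeft K K (Fin.castAdd (simpleDim i j))

theorem trunc_surjective (j : Vertex m) : Function.Surjective (trunc K b i j) :=
  LinearMap.funLeft_surjective_of_injective _ _ _ (Fin.castAdd_injective _ _)

variable (b i) in
/-- The index of the last coordinate of `K^{b_i + 1}`. -/
def lastCoord : Fin ((b + simpleDim i) i) :=
  Fin.natAdd (b i) ⟨0, by simp⟩

theorem eq_of_trunc_eq_of_lastCoord_eq {v v' : Fin ((b + simpleDim i) i) → K}
    (h : trunc K b i i v = trunc K b i i v') (hlast : v (lastCoord b i) = v' (lastCoord b i)) :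
    v = v' := by
  have : Subsingleton (Fin (simpleDim i i)) := by
    rw [show simpleDim i i = 1 from Pi.single_eq_same i 1]
    infer_instance
  refine funext (Fin.addCases (congrFun h) fun s => ?_)
  rwa [Subsingleton.elim s _]

open Classical in
/-- A family of rows indexed by `in₁(i)`, extended by zero. -/
def extRow (w : (Σ j : in1 i, Fin (b j)) → K) (j : Vertex m) : Fin (b j) → K :=
  if h : j ∈ in1 i then fun c => w ⟨⟨j, h⟩, c⟩ else 0

theorem extRow_of_hom (w : (Σ j : in1 i, Fin (b j)) → K) {j : Vertex m} (τ : j ⟶ i) :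
    extRow w j = fun c => w ⟨source τ, c⟩ :=
  dif_pos τ.down

/-- The matrices `f'_τ`, to which the row given by `w` is added if `τ` ends in `i`. -/
def extMatrix (f' : Rep K b) (w : (Σ j : in1 i, Fin (b j)) → K) {j l : Vertex m} (τ : j ⟶ l) :
    Matrix (Fin ((b + simpleDim i) l)) (Fin (b j)) K :=
  Fin.append (LinearMap.toMatrix' (f' τ)) fun _ => extRow w j

/-- The extension of `f'` by the simple representation at `i` in which the last rows of the arrows
that end in `i` are given by `w`. -/
def extRep (f' : Rep K b) (w : (Σ j : in1 i, Fin (b j)) → K) : Rep K (b + simpleDim i) :=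
  fun j _ τ => Matrix.toLin' (extMatrix f' w τ) ∘ₗ trunc K b i j

variable {f' : Rep K b} {w : (Σ j : in1 i, Fin (b j)) → K}

theorem isMorphism_extRep : IsMorphism (extRep f' w) f' (trunc K b i) := by
  intro j l τ
  refine LinearMap.ext fun v => funext fun r => ?_
  rw [LinearMap.comp_apply, LinearMap.comp_apply, ← LinearMap.toMatrix'_mulVec (f' τ)]
  exact congrArg (· ⬝ᵥ trunc K b i j v) (Fin.append_left (LinearMap.toMatrix' (f' τ)) _ r)

theorem extRep_apply_lastCoord {j : Vertex m} (τ : j ⟶ i) (v : Fin ((b + simpleDim i) j) → K) :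
    extRep f' w τ v (lastCoord b i) = (fun c => w ⟨source τ, c⟩) ⬝ᵥ trunc K b i j v := by
  rw [← extRow_of_hom w τ]
  exact congrArg (· ⬝ᵥ trunc K b i j v)
    (Fin.append_right (LinearMap.toMatrix' (f' τ)) (fun _ => extRow w j) _)

theorem extRep_comp_eq_iff (hf' : f'.Commutes) {l j j' : Vertex m} (σ : l ⟶ j) (τ : j ⟶ i)
    (σ' : l ⟶ j') (τ' : j' ⟶ i) :
    extRep f' w τ ∘ₗ extRep f' w σ = extRep f' w τ' ∘ₗ extRep f' w σ' ↔
      ∀ v, (fun c => w ⟨source τ, c⟩) ⬝ᵥ f' σ v = (fun c => w ⟨source τ', c⟩) ⬝ᵥ f' σ' v := by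
  have hm : IsMorphism (extRep f' w) f' (trunc K b i) := isMorphism_extRep
  have hc : f' τ ∘ₗ f' σ = f' τ' ∘ₗ f' σ' :=
    hf' l i ((Quiver.Path.nil.cons σ).cons τ) ((Quiver.Path.nil.cons σ').cons τ')
  rw [(trunc_surjective (K := K) (b := b) (i := i) l).forall]
  simp only [← hm.apply, ← extRep_apply_lastCoord (f' := f')]
  refine ⟨fun h v => congrFun (LinearMap.congr_fun h v) _, fun h => LinearMap.ext fun v => ?_⟩
  refine eq_of_trunc_eq_of_lastCoord_eq ?_ (h v)
  rw [LinearMap.comp_apply, LinearMap.comp_apply, hm.apply, hm.apply, hm.apply, hm.apply]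
  exact LinearMap.congr_fun hc _

theorem extRep_commutes_iff {f' : EC k K b} :
    (extRep f'.1 w).Commutes ↔ FStar i f' (fun j c => w ⟨j, c⟩) = 0 := by
  rw [FStar_eq_zero_iff]
  constructor
  · intro h l j j' σ τ σ' τ' _
    exact (extRep_comp_eq_iff f'.2 σ τ σ' τ').1
      (h l i ((Quiver.Path.nil.cons σ).cons τ) ((Quiver.Path.nil.cons σ').cons τ'))
  · intro h
    refine commutes_of_squares (i := i) (fun j l p q hl => ?_) fun l j j' σ τ σ' τ' hne =>
      (extRep_comp_eq_iff f'.2 σ τ σ' τ').2 (h σ τ σ' τ' hne)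
    rw [← LinearMap.cancel_left (injective_of_surjective_of_ne (trunc_surjective (K := K)) hl),
      isMorphism_extRep.eval, isMorphism_extRep.eval, f'.2 j l p q]

theorem IsMorphism.exists_eq_extRep {f : Rep K (b + simpleDim i)}
    (h : IsMorphism f f' (trunc K b i)) :
    ∃ w : (Σ j : in1 i, Fin (b j)) → K, f = extRep f' w := by
  choose s hs using fun j => (trunc K b i j).exists_rightInverse_of_surjective
    (LinearMap.range_eq_top.2 (trunc_surjective j))
  let w : (Σ j : in1 i, Fin (b j)) → K :=
    fun a => (f ⟨a.1.2⟩ ∘ₗ s a.1) (Pi.single a.2 1) (lastCoord b i)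
  have hm : IsMorphism (extRep f' w) f' (trunc K b i) := isMorphism_extRep
  refine ⟨w, funext fun j => funext fun l => funext fun τ => LinearMap.ext fun v => ?_⟩
  have htrunc : trunc K b i l (f τ v) = trunc K b i l (extRep f' w τ v) := by
    rw [h.apply, hm.apply]
  rcases eq_or_ne l i with rfl | hl
  · refine eq_of_trunc_eq_of_lastCoord_eq htrunc ?_
    have hv : s j (trunc K b l j v) = v :=
      injective_of_surjective_of_ne (trunc_surjective (K := K)) (ne_of_hom τ)
        (LinearMap.congr_fun (hs j) _)
    have hw : (f τ ∘ₗ s j) (trunc K b l j v) (lastCoord b l) =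
        (fun c => w ⟨source τ, c⟩) ⬝ᵥ trunc K b l j v := by
      rw [← LinearMap.toMatrix'_mulVec (f τ ∘ₗ s j)]
      rfl
    rw [extRep_apply_lastCoord, ← hw, LinearMap.comp_apply, hv]
  · exact injective_of_surjective_of_ne (trunc_surjective (K := K)) hl htrunc

theorem exists_extension (f' : EC k K b) :
    ∃ f : EC k K (b + simpleDim i), HasQuotient f f' :=
  ⟨⟨extRep f'.1 0, extRep_commutes_iff.2 (map_zero _)⟩, trunc K b i, trunc_surjective,
    isMorphism_extRep⟩

end StandardExtensions

/-! ### Matrices of regular functions -/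

section RegularMatrices

variable {k K Z p q r : Type*} [CommRing k] [Field K] [Algebra k K] {C : Subalgebra k (Z → K)}

/-- The family of matrices `M z` has entries in the ring `C` of functions of `z`. -/
def IsRegularMatrix (C : Subalgebra k (Z → K)) (M : Z → Matrix p q K) : Prop :=
  ∀ r s, (fun z => M z r s) ∈ C

theorem IsRegularMatrix.mul [Fintype q] {M : Z → Matrix p q K} {N : Z → Matrix q r K}
    (hM : IsRegularMatrix C M) (hN : IsRegularMatrix C N) :
    IsRegularMatrix C fun z => M z * N z := by
  intro r s
  have hsum : (fun z => (M z * N z) r s) = ∑ t, (fun z => M z r t) * fun z => N z t s := by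
    funext z
    simp [Matrix.mul_apply]
  rw [hsum]
  exact C.sum_mem fun t _ => C.mul_mem (hM r t) (hN t s)

theorem IsRegularMatrix.exists_eq_map {M : Z → Matrix p q K} (hM : IsRegularMatrix C M) :
    ∃ N : Matrix p q C, ∀ z, N.map (evalAt C z) = M z :=
  ⟨fun r s => ⟨_, hM r s⟩, fun _ => rfl⟩

variable [Fintype p] [DecidableEq p] {M : Z → Matrix p p K}

theorem IsRegularMatrix.det_mem (hM : IsRegularMatrix C M) : (fun z => (M z).det) ∈ C := by
  obtain ⟨N, hN⟩ := hM.exists_eq_map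
  convert N.det.2 using 1
  funext z
  rw [← hN]
  exact ((evalAt C z).map_det N).symm

theorem IsRegularMatrix.inv (hM : IsRegularMatrix C M)
    (hC : ∀ g : C, (∀ z, (g : Z → K) z ≠ 0) → IsUnit g) (hdet : ∀ z, (M z).det ≠ 0) :
    IsRegularMatrix C fun z => (M z)⁻¹ := by
  obtain ⟨N, hN⟩ := hM.exists_eq_map
  have hdetN (z) : (N.det : Z → K) z = (M z).det := by
    rw [← hN]
    exact (evalAt C z).map_det N
  have hunit : IsUnit N.det := hC _ fun z => by
    rw [hdetN]
    exact hdet z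
  have hinv (z) : (M z)⁻¹ = N⁻¹.map (evalAt C z) := by
    refine Matrix.inv_eq_right_inv ?_
    rw [← hN, ← Matrix.map_mul, Matrix.mul_nonsing_inv _ hunit, Matrix.map_one _ (map_zero _)
      (map_one _)]
  intro r s
  simp only [hinv]
  exact (N⁻¹ r s).2

end RegularMatrices

/-! ### Changes of bases -/

section Conj

variable {d : ℕ} {m : Fin d → ℕ} {k K : Type*} [Field K] {n b : Vertex m → ℕ} {i : Vertex m}

theorem EC.ext {f g : EC k K n}
    (h : ∀ ⦃j l : Vertex m⦄ (τ : j ⟶ l) (v : Fin (n j) → K), f.1 τ v = g.1 τ v) : f = g :=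
  Subtype.ext <| funext fun _ => funext fun _ => funext fun τ => LinearMap.ext (h τ)

/-- The representation obtained from `f` by a change of bases. -/
def conj (e : ∀ j, (Fin (n j) → K) ≃ₗ[K] (Fin (n j) → K)) (f : EC k K n) : EC k K n :=
  ⟨fun j l τ => (e l).toLinearMap ∘ₗ f.1 τ ∘ₗ (e j).symm.toLinearMap,
    IsMorphism.commutes (f := f.1) (φ := fun j => (e j).toLinearMap)
      (fun j l τ => LinearMap.ext fun v => by simp) (fun j => (e j).surjective) f.2⟩

variable {e : ∀ j, (Fin (n j) → K) ≃ₗ[K] (Fin (n j) → K)} {f : EC k K n}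

theorem conj_apply {j l : Vertex m} (τ : j ⟶ l) (v : Fin (n j) → K) :
    (conj e f).1 τ v = e l (f.1 τ ((e j).symm v)) := rfl

theorem eq_conj_iff {g : EC k K n} : f = conj e g ↔ conj (fun j => (e j).symm) f = g := by
  constructor
  · rintro rfl
    exact EC.ext fun j l τ v => by simp [conj_apply]
  · rintro rfl
    exact EC.ext fun j l τ v => by simp [conj_apply]

theorem toMatrix_conj {j l : Vertex m} (τ : j ⟶ l) :
    LinearMap.toMatrix' ((conj e f).1 τ) = LinearMap.toMatrix' (e l).toLinearMap *
      (LinearMap.toMatrix' (f.1 τ) * LinearMap.toMatrix' (e j).symm.toLinearMap) := by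
  rw [← LinearMap.toMatrix'_comp, ← LinearMap.toMatrix'_comp]
  rfl

theorem hasQuotient_iff_exists_isMorphism_trunc {f : EC k K (b + simpleDim i)} {f' : EC k K b} :
    HasQuotient f f' ↔
      ∃ e : ∀ j, (Fin ((b + simpleDim i) j) → K) ≃ₗ[K] (Fin ((b + simpleDim i) j) → K),
        IsMorphism (conj (fun j => (e j).symm) f).1 f'.1 (trunc K b i) := by
  constructor
  · rintro ⟨φ, hφ, h⟩
    choose e he using fun j => exists_linearEquiv_comp_eq (hφ j) (trunc_surjective (K := K) j)
    refine ⟨e, fun j l τ => LinearMap.ext fun v => ?_⟩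
    simp [← he, conj_apply, h.apply]
  · rintro ⟨e, h⟩
    refine ⟨fun j => trunc K b i j ∘ₗ (e j).symm.toLinearMap, fun j =>
      (trunc_surjective j).comp (e j).symm.surjective, fun j l τ => LinearMap.ext fun v => ?_⟩
    simpa [conj_apply] using h.apply τ ((e j).symm v)

theorem hasQuotient_iff_exists_eq_conj_extRep {f : EC k K (b + simpleDim i)} {f' : EC k K b} :
    HasQuotient f f' ↔
      ∃ (e : ∀ j, (Fin ((b + simpleDim i) j) → K) ≃ₗ[K] (Fin ((b + simpleDim i) j) → K))
        (w : (Σ j : in1 i, Fin (b j)) → K) (hw : (extRep f'.1 w).Commutes),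
        f = conj e ⟨extRep f'.1 w, hw⟩ := by
  rw [hasQuotient_iff_exists_isMorphism_trunc]
  refine exists_congr fun e => ⟨fun h => ?_, ?_⟩
  · obtain ⟨w, hw⟩ := h.exists_eq_extRep
    exact ⟨w, hw ▸ (conj _ f).2, eq_conj_iff.2 (Subtype.ext hw)⟩
  · rintro ⟨w, hw, h⟩
    rw [eq_conj_iff.1 h]
    exact isMorphism_extRep

theorem trunc_single_lastCoord : trunc K b i i (Pi.single (lastCoord b i) 1) = 0 := by
  funext r
  have hr : Fin.castAdd (simpleDim i i) r ≠ lastCoord b i := fun h =>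
    r.isLt.ne (congrArg Fin.val h)
  simp [trunc, LinearMap.funLeft_apply, hr]

theorem trunc_single_castAdd (j : Vertex m) (c : Fin (b j)) :
    trunc K b i j (Pi.single (Fin.castAdd _ c) 1) = Pi.single c 1 := by
  funext r
  simp [trunc, LinearMap.funLeft_apply, Pi.single_apply]

theorem exists_isMorphism_trunc_iff {g : EC k K (b + simpleDim i)} :
    (∃ f' : EC k K b, IsMorphism g.1 f'.1 (trunc K b i)) ↔
      ∀ (l : Vertex m) (τ : i ⟶ l), g.1 τ (Pi.single (lastCoord b i) 1) = 0 := by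
  constructor
  · rintro ⟨f', h⟩ l τ
    rw [h.apply_eq_zero_iff trunc_surjective, trunc_single_lastCoord, map_zero]
  · intro h
    refine exists_isMorphism g trunc_surjective fun j l τ v hv => ?_
    rcases eq_or_ne j i with rfl | hj
    · have hv' : v = v (lastCoord b j) • Pi.single (lastCoord b j) 1 :=
        eq_of_trunc_eq_of_lastCoord_eq
          (by rw [hv, map_smul, trunc_single_lastCoord, smul_zero]) (by simp)
      rw [hv', map_smul, h l τ, smul_zero, map_zero]
    · rw [injective_of_surjective_of_ne (trunc_surjective (K := K)) hj (hv.trans (map_zero _).symm),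
        map_zero, map_zero]

theorem epsMatrix_mulVec_eq_zero_iff_exists_isMorphism [Field k] [Algebra k K]
    {f : EC k K (b + simpleDim i)}
    {u : ∀ j, (Fin ((b + simpleDim i) j) → K) ≃ₗ[K] (Fin ((b + simpleDim i) j) → K)} :
    ((epsMatrix k K _ i).map (evalAt _ f)).mulVec (u i (Pi.single (lastCoord b i) 1)) = 0 ↔
      ∃ f' : EC k K b, IsMorphism (conj (fun j => (u j).symm) f).1 f'.1 (trunc K b i) := by
  rw [epsMatrix_mulVec_eq_zero_iff, exists_isMorphism_trunc_iff]
  simp only [conj_apply, LinearEquiv.symm_symm, LinearEquiv.map_eq_zero_iff]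

theorem IsMorphism.toMatrix_eq_submatrix {g : Rep K (b + simpleDim i)} {f' : Rep K b}
    (h : IsMorphism g f' (trunc K b i)) {j l : Vertex m} (τ : j ⟶ l) : LinearMap.toMatrix' (f' τ) =
      (LinearMap.toMatrix' (g τ)).submatrix (Fin.castAdd _) (Fin.castAdd _) := by
  ext r c
  rw [LinearMap.toMatrix'_apply, ← trunc_single_castAdd (i := i), ← h.apply]
  simp [trunc, LinearMap.funLeft_apply, LinearMap.toMatrix'_apply]

end Conj

/-! ### Frames -/

section Frames

variable {d : ℕ} {m : Fin d → ℕ} {K : Type*} [Field K] {n : Vertex m → ℕ}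

/-- The indices of the entries of a family of square matrices with row sizes `n`. -/
abbrev FrameEntry (n : Vertex m → ℕ) : Type := Σ j, Fin (n j) × Fin (n j)

/-- The matrices with given entries. -/
def frameMatrix (c : FrameEntry n → K) (j : Vertex m) : Matrix (Fin (n j)) (Fin (n j)) K :=
  Matrix.of fun r s => c ⟨j, r, s⟩

/-- The changes of bases given by the entries of invertible matrices. -/
def frameEquiv (c : FrameEntry n → K) (hc : ∀ j, (frameMatrix c j).det ≠ 0) (j : Vertex m) :
    (Fin (n j) → K) ≃ₗ[K] (Fin (n j) → K) :=
  Matrix.toLin'OfInv (Matrix.nonsing_inv_mul _ (hc j).isUnit)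
    (Matrix.mul_nonsing_inv _ (hc j).isUnit)

theorem toMatrix_frameEquiv (c : FrameEntry n → K) (hc : ∀ j, (frameMatrix c j).det ≠ 0)
    (j : Vertex m) : LinearMap.toMatrix' (frameEquiv c hc j).toLinearMap = frameMatrix c j :=
  LinearMap.toMatrix'_toLin' _

theorem toMatrix_frameEquiv_symm (c : FrameEntry n → K) (hc : ∀ j, (frameMatrix c j).det ≠ 0)
    (j : Vertex m) :
    LinearMap.toMatrix' (frameEquiv c hc j).symm.toLinearMap = (frameMatrix c j)⁻¹ :=
  LinearMap.toMatrix'_toLin' _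

theorem exists_eq_frameEquiv (e : ∀ j, (Fin (n j) → K) ≃ₗ[K] (Fin (n j) → K)) :
    ∃ c, ∃ hc : ∀ j, (frameMatrix c j).det ≠ 0, e = frameEquiv c hc := by
  let c : FrameEntry n → K := fun a => LinearMap.toMatrix' (e a.1).toLinearMap a.2.1 a.2.2
  have hc (j) : (frameMatrix c j).det ≠ 0 := by
    have hinv : frameMatrix c j * LinearMap.toMatrix' (e j).symm.toLinearMap = 1 := by
      refine (LinearMap.toMatrix'_comp (e j).toLinearMap _).symm.trans ?_
      rw [LinearEquiv.comp_symm, LinearMap.toMatrix'_id]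
    exact (Matrix.isUnit_det_of_right_inverse hinv).ne_zero
  refine ⟨c, hc, funext fun j => LinearEquiv.toLinearMap_injective ?_⟩
  exact LinearMap.toMatrix'.injective (toMatrix_frameEquiv c hc j).symm

theorem frameEquiv_apply_single (c : FrameEntry n → K) (hc : ∀ j, (frameMatrix c j).det ≠ 0)
    (j : Vertex m) (s : Fin (n j)) :
    frameEquiv c hc j (Pi.single s 1) = fun r => c ⟨j, r, s⟩ :=
  Matrix.mulVec_single_one (frameMatrix c j) s

variable {k X τ : Type*} [CommRing k] [Algebra k K] {A : Subalgebra k (X → K)}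
  {κ : FrameEntry n → τ} {S : Set (X × (τ → K))}

/-- The points of `S` at which the coordinates selected by `κ` form invertible matrices. -/
def frameLocus (κ : FrameEntry n → τ) (S : Set (X × (τ → K))) : Set (X × (τ → K)) :=
  {p ∈ S | ∀ j, (frameMatrix (p.2 ∘ κ) j).det ≠ 0}

theorem isRegularMatrix_frameMatrix (j : Vertex m) :
    IsRegularMatrix (polyExt A τ) fun p => frameMatrix (p.2 ∘ κ) j :=
  fun r s => coord_mem_polyExt (κ ⟨j, r, s⟩)

theorem IsPreirreducibleFor.frameLocus (hS : IsPreirreducibleFor (polyExt A τ) S) :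
    IsPreirreducibleFor (polyExt A τ) (frameLocus κ S) := by
  have hdet : ∏ j, (fun p : X × (τ → K) => (frameMatrix (p.2 ∘ κ) j).det) ∈ polyExt A τ :=
    Subalgebra.prod_mem _ fun j _ => (isRegularMatrix_frameMatrix j).det_mem
  simpa [PersistenceCrystal.frameLocus, Finset.prod_ne_zero_iff] using hS.inter_ne_zero hdet

/-- The change of bases attached to a point of the frame locus. -/
abbrev frameAt (p : frameLocus κ S) (j : Vertex m) : (Fin (n j) → K) ≃ₗ[K] (Fin (n j) → K) :=
  frameEquiv (p.1.2 ∘ κ) p.2.2 j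

theorem isRegularMatrix_frameAt (j : Vertex m) :
    IsRegularMatrix (regularOn (polyExt A τ) (frameLocus κ S)) fun p =>
      LinearMap.toMatrix' (frameAt p j).toLinearMap := by
  simp only [toMatrix_frameEquiv]
  exact fun r s => restrict_mem_regularOn (isRegularMatrix_frameMatrix j r s)

theorem isRegularMatrix_frameAt_symm (j : Vertex m) :
    IsRegularMatrix (regularOn (polyExt A τ) (frameLocus κ S)) fun p =>
      LinearMap.toMatrix' (frameAt p j).symm.toLinearMap := by
  simp only [toMatrix_frameEquiv_symm]
  exact IsRegularMatrix.inv
    (fun r s => restrict_mem_regularOn (isRegularMatrix_frameMatrix j r s))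
    (fun _ => isUnit_of_forall_ne_zero) fun p => p.2.2 j

end Frames

/-! ### Irreducibility of the correspondence -/

section Correspondence

variable {d : ℕ} {m : Fin d → ℕ} {k K : Type*} [Field k] [Field K] [Algebra k K]
  {b : Vertex m → ℕ} {i : Vertex m}

section Regularity

variable {Z : Type*} {C : Subalgebra k (Z → K)}

theorem isRegularMatrix_conj {n : Vertex m → ℕ} {f : Z → EC k K n}
    {e : Z → ∀ j, (Fin (n j) → K) ≃ₗ[K] (Fin (n j) → K)}
    (he : ∀ j, IsRegularMatrix C fun z => LinearMap.toMatrix' (e z j).toLinearMap)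
    (he' : ∀ j, IsRegularMatrix C fun z => LinearMap.toMatrix' (e z j).symm.toLinearMap)
    {j l : Vertex m} {τ : j ⟶ l} (hf : IsRegularMatrix C fun z => LinearMap.toMatrix' ((f z).1 τ)) :
    IsRegularMatrix C fun z => LinearMap.toMatrix' ((conj (e z) (f z)).1 τ) := by
  simpa only [← toMatrix_conj] using (he l).mul (hf.mul (he' j))

theorem isRegularMatrix_trunc (j : Vertex m) :
    IsRegularMatrix C fun _ => LinearMap.toMatrix' (trunc K b i j) := by
  intro r s
  have hrs : LinearMap.toMatrix' (trunc K b i j) r s = if Fin.castAdd _ r = s then 1 else 0 := by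
    rw [LinearMap.toMatrix'_apply, trunc, LinearMap.funLeft_apply, Pi.single_apply]
  simp only [hrs]
  split_ifs
  · exact C.one_mem
  · exact C.zero_mem

theorem isRegularMatrix_extMatrix {f' : Z → Rep K b} {w : Z → (Σ j : in1 i, Fin (b j)) → K}
    (hw : ∀ a, (fun z => w z a) ∈ C) {j l : Vertex m} {τ : j ⟶ l}
    (hf' : IsRegularMatrix C fun z => LinearMap.toMatrix' (f' z τ)) :
    IsRegularMatrix C fun z => extMatrix (f' z) (w z) τ := by
  refine Fin.addCases (fun r s => ?_) fun r s => ?_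
  · convert hf' r s using 2 with z
    exact congrFun (Fin.append_left (LinearMap.toMatrix' (f' z τ)) _ r) s
  · have happ (z) : extMatrix (f' z) (w z) τ (Fin.natAdd (b l) r) s = extRow (w z) j s :=
      congrFun (Fin.append_right (LinearMap.toMatrix' (f' z τ)) _ r) s
    simp only [happ, extRow]
    split_ifs with h
    · exact hw _
    · exact C.zero_mem

theorem isRegularMatrix_extRep {f' : Z → Rep K b} {w : Z → (Σ j : in1 i, Fin (b j)) → K}
    (hw : ∀ a, (fun z => w z a) ∈ C) {j l : Vertex m} {τ : j ⟶ l}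
    (hf' : IsRegularMatrix C fun z => LinearMap.toMatrix' (f' z τ)) :
    IsRegularMatrix C fun z => LinearMap.toMatrix' (extRep (f' z) (w z) τ) := by
  simp only [extRep, LinearMap.toMatrix'_comp, LinearMap.toMatrix'_toLin']
  exact (isRegularMatrix_extMatrix hw hf').mul (isRegularMatrix_trunc j)

theorem isRegularMatrix_of_isMorphism {g : Z → EC k K (b + simpleDim i)} {f' : Z → EC k K b}
    (h : ∀ z, IsMorphism (g z).1 (f' z).1 (trunc K b i)) {j l : Vertex m} {τ : j ⟶ l}
    (hg : IsRegularMatrix C fun z => LinearMap.toMatrix' ((g z).1 τ)) :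
    IsRegularMatrix C fun z => LinearMap.toMatrix' ((f' z).1 τ) := by
  simp only [(h _).toMatrix_eq_submatrix]
  exact fun r s => hg _ _

end Regularity

variable [Infinite K]

theorem isPreirreducible_extensionPairs {T : Set (EC k K b)} (hT : IsPreirreducible T)
    (hdim : ∀ f ∈ T, ∀ g ∈ T, Module.finrank K (ExtStar i f) = Module.finrank K (ExtStar i g)) :
    IsPreirreducible
      {p : EC k K (b + simpleDim i) × EC k K b | p.2 ∈ T ∧ HasQuotient p.1 p.2} := by
  let τ := (Σ j : in1 i, Fin (b j)) ⊕ FrameEntry (b + simpleDim i)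
  let S : Set (EC k K b × (τ → K)) :=
    {p | p.1 ∈ T ∧ ((fStarMatrix k K b i).map (evalAt _ p.1)).mulVec (p.2 ∘ Sum.inl) = 0}
  have hS : IsPreirreducibleFor (polyExt (regEC k K b) τ) S :=
    (isPreirreducibleFor_of_isPreirreducible (fun _ => isOpen_support_of_mem_regEC)
      hT).kernels_comp _ (fun f hf g hg => rank_eq_iff_finrank_ker_eq.2
        (by simpa only [finrank_extStar_eq] using hdim f hf g hg)) Sum.inl_injective
  let κ : FrameEntry (b + simpleDim i) → τ := Sum.inr
  let extAt (p : frameLocus κ S) : EC k K (b + simpleDim i) :=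
    ⟨extRep p.1.1.1 (p.1.2 ∘ Sum.inl),
      extRep_commutes_iff.2 (fStarMatrix_mulVec_eq_zero_iff.1 p.2.1.2)⟩
  have hrange : {p : EC k K (b + simpleDim i) × EC k K b | p.2 ∈ T ∧ HasQuotient p.1 p.2} =
      Set.range fun p : frameLocus κ S => (conj (frameAt p) (extAt p), p.1.1) := by
    ext ⟨f, f'⟩
    change f' ∈ T ∧ HasQuotient f f' ↔ _
    rw [hasQuotient_iff_exists_eq_conj_extRep]
    constructor
    · rintro ⟨hf', e, w, hw, rfl⟩
      obtain ⟨c, hc, rfl⟩ := exists_eq_frameEquiv e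
      have hker := fStarMatrix_mulVec_eq_zero_iff.2 (extRep_commutes_iff.1 hw)
      exact ⟨⟨(f', Sum.elim w c), ⟨hf', hker⟩, hc⟩, rfl⟩
    · rintro ⟨p, h⟩
      obtain ⟨rfl, rfl⟩ := Prod.mk.inj h
      exact ⟨p.2.1.1, frameAt p, _, _, rfl⟩
  rw [hrange]
  refine hS.frameLocus.regularOn_univ.isPreirreducible_range_prodMk
    isTopologicalBasis_support_regEC isTopologicalBasis_support_regEC
    (fun a ha => comp_mem_of_forall_toMatrix_mem (fun j l σ => isRegularMatrix_conj
      isRegularMatrix_frameAt isRegularMatrix_frameAt_symm (isRegularMatrix_extRep ?_ ?_)) ha)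
    fun a ha => restrict_mem_regularOn (comp_fst_mem_polyExt ha)
  · exact fun a => restrict_mem_regularOn (coord_mem_polyExt _)
  · exact fun r s => restrict_mem_regularOn (comp_fst_mem_polyExt (genericMatrix k K b σ r s).2)

theorem isPreirreducible_quotientPairs {T : Set (EC k K (b + simpleDim i))}
    (hT : IsPreirreducible T) (heps : ∀ f ∈ T, ∀ g ∈ T, epsStarPt i f = epsStarPt i g) :
    IsPreirreducible
      {p : EC k K (b + simpleDim i) × EC k K b | p.1 ∈ T ∧ HasQuotient p.1 p.2} := by
  let τ := FrameEntry (b + simpleDim i)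
  let ι (r : Fin ((b + simpleDim i) i)) : τ := ⟨i, r, lastCoord b i⟩
  have hι_inj : Function.Injective ι :=
    sigma_mk_injective.comp (Prod.mk_left_injective (lastCoord b i))
  let S : Set (EC k K (b + simpleDim i) × (τ → K)) :=
    {p | p.1 ∈ T ∧ ((epsMatrix k K _ i).map (evalAt _ p.1)).mulVec (p.2 ∘ ι) = 0}
  have hS : IsPreirreducibleFor (polyExt (regEC k K _) τ) S :=
    (isPreirreducibleFor_of_isPreirreducible (fun _ => isOpen_support_of_mem_regEC)
      hT).kernels_comp _ (fun f hf g hg => rank_eq_iff_finrank_ker_eq.2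
        (by simpa only [epsStarPt_eq] using heps f hf g hg)) hι_inj
  have hι (c : τ → K) (hc) : c ∘ ι = frameEquiv c hc i (Pi.single (lastCoord b i) 1) :=
    (frameEquiv_apply_single c hc i _).symm
  have hmor (p : frameLocus id S) : ∃ f' : EC k K b,
      IsMorphism (conj (fun j => (frameAt p j).symm) p.1.1).1 f'.1 (trunc K b i) :=
    epsMatrix_mulVec_eq_zero_iff_exists_isMorphism.1 (hι p.1.2 p.2.2 ▸ p.2.1.2)
  choose quot hquot using hmor
  have hrange : {p : EC k K (b + simpleDim i) × EC k K b | p.1 ∈ T ∧ HasQuotient p.1 p.2} =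
      Set.range fun p : frameLocus id S => (p.1.1, quot p) := by
    ext ⟨f, f'⟩
    change f ∈ T ∧ HasQuotient f f' ↔ _
    rw [hasQuotient_iff_exists_isMorphism_trunc]
    constructor
    · rintro ⟨hf, e, he⟩
      obtain ⟨c, hc, rfl⟩ := exists_eq_frameEquiv e
      have hker := epsMatrix_mulVec_eq_zero_iff_exists_isMorphism.2 ⟨f', he⟩
      let p : frameLocus id S := ⟨(f, c), ⟨hf, (hι c hc).symm ▸ hker⟩, hc⟩
      exact ⟨p, Prod.ext rfl (Subtype.ext ((hquot p).unique he trunc_surjective))⟩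
    · rintro ⟨p, h⟩
      obtain ⟨rfl, rfl⟩ := Prod.mk.inj h
      exact ⟨p.2.1.1, frameAt p, hquot p⟩
  rw [hrange]
  refine hS.frameLocus.regularOn_univ.isPreirreducible_range_prodMk
    isTopologicalBasis_support_regEC isTopologicalBasis_support_regEC
    (fun a ha => restrict_mem_regularOn (comp_fst_mem_polyExt ha))
    fun a ha => comp_mem_of_forall_toMatrix_mem (fun j l σ => isRegularMatrix_of_isMorphism hquot
      (isRegularMatrix_conj isRegularMatrix_frameAt_symm isRegularMatrix_frameAt fun r s => ?_)) ha
  exact restrict_mem_regularOn (comp_fst_mem_polyExt (genericMatrix k K _ σ r s).2)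

end Correspondence

/-! ### The operators on components -/

section Operators

variable {d : ℕ} {m : Fin d → ℕ}

section Images

variable {k K : Type*} [Field K] {n b : Vertex m → ℕ}

variable (n) in
/-- The representations with dimension vector `n` that have a quotient in `T`. For
`n = b + simpleDim i` this is the set `ϖ₄(ϖ₃⁻¹(T))`. -/
def extensions (T : Set (EC k K b)) : Set (EC k K n) := {f | ∃ f' ∈ T, HasQuotient f f'}

variable (b) in
/-- The quotients with dimension vector `b` of the representations in `T`. For
`n = b + simpleDim i` this is the set `ϖ₃(ϖ₄⁻¹(T))`. -/
def quotients (T : Set (EC k K n)) : Set (EC k K b) := {f' | ∃ f ∈ T, HasQuotient f f'}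

theorem extensions_eq_image_fst (T : Set (EC k K b)) :
    extensions n T = Prod.fst '' {p : EC k K n × EC k K b | p.2 ∈ T ∧ HasQuotient p.1 p.2} := by
  ext f
  exact ⟨fun ⟨f', h⟩ => ⟨(f, f'), h, rfl⟩, fun ⟨p, h, hp⟩ => hp ▸ ⟨p.2, h⟩⟩

theorem quotients_eq_image_snd (T : Set (EC k K n)) :
    quotients b T = Prod.snd '' {p : EC k K n × EC k K b | p.1 ∈ T ∧ HasQuotient p.1 p.2} := by
  ext f'
  exact ⟨fun ⟨f, h⟩ => ⟨(f, f'), h, rfl⟩, fun ⟨p, h, hp⟩ => hp ▸ ⟨p.1, h⟩⟩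

theorem image_varpi4_preimage_varpi3 {a : Vertex m → ℕ} (hn : ∀ j, n j = b j + a j)
    (T : Set (EC k K b)) :
    varpi4 k '' ((varpi3 k : ExtPoint K a b n → EC k K b) ⁻¹' T) = extensions n T := by
  ext f
  constructor
  · rintro ⟨x, hx, rfl⟩
    exact ⟨_, hx, (exists_extPoint_iff_hasQuotient hn).1 ⟨x, rfl, rfl⟩⟩
  · rintro ⟨f', hf', h⟩
    obtain ⟨x, rfl, rfl⟩ := (exists_extPoint_iff_hasQuotient hn).2 h
    exact ⟨x, hf', rfl⟩

theorem image_varpi3_preimage_varpi4 {a : Vertex m → ℕ} (hn : ∀ j, n j = b j + a j)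
    (T : Set (EC k K n)) :
    varpi3 k '' ((varpi4 k : ExtPoint K a b n → EC k K n) ⁻¹' T) = quotients b T := by
  ext f'
  constructor
  · rintro ⟨x, hx, rfl⟩
    exact ⟨_, hx, (exists_extPoint_iff_hasQuotient hn).1 ⟨x, rfl, rfl⟩⟩
  · rintro ⟨f, hf, h⟩
    obtain ⟨x, rfl, rfl⟩ := (exists_extPoint_iff_hasQuotient hn).2 h
    exact ⟨x, hf, rfl⟩

end Images

theorem closure_eq_of_mem_irreducibleComponents {X : Type*} [TopologicalSpace X] {Z S : Set X}
    (hZ : Z ∈ irreducibleComponents X) (hS : IsPreirreducible S) (h : Z ⊆ closure S) :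
    closure S = Z :=
  (hZ.eq_of_le (isIrreducible_iff_closure.2 ⟨closure_nonempty_iff.1 (hZ.1.1.mono h), hS⟩) h).symm

section Loci

variable {k K : Type*} [Field k] [Field K] [Algebra k K] {b : Vertex m → ℕ} {i : Vertex m}
  {Λ : Set (EC k K b)} {Λ' : Set (EC k K (b + simpleDim i))}

theorem closure_locus3 (hΛ : Λ ∈ irreducibleComponents (EC k K b)) :
    closure (locus3 i Λ) = Λ :=
  closure_minLocus (upperSemicontinuous_finrank_extStar i) hΛ.1
    (isClosed_of_mem_irreducibleComponents Λ hΛ)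

theorem closure_locus4 (hΛ : Λ ∈ irreducibleComponents (EC k K b)) :
    closure (locus4 i Λ) = Λ :=
  closure_minLocus (upperSemicontinuous_epsStarPt i) hΛ.1
    (isClosed_of_mem_irreducibleComponents Λ hΛ)

theorem isIrreducible_locus3 (hΛ : Λ ∈ irreducibleComponents (EC k K b)) :
    IsIrreducible (locus3 i Λ) :=
  isIrreducible_iff_closure.1 ((closure_locus3 hΛ).symm ▸ hΛ.1)

theorem isIrreducible_locus4 (hΛ : Λ ∈ irreducibleComponents (EC k K b)) :
    IsIrreducible (locus4 i Λ) :=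
  isIrreducible_iff_closure.1 ((closure_locus4 hΛ).symm ▸ hΛ.1)

theorem subset_closure_locus3_inter_locus4 (hΛ : Λ ∈ irreducibleComponents (EC k K b)) :
    Λ ⊆ closure (locus3 i Λ ∩ locus4 i Λ) := by
  obtain ⟨U, hU, hΛU⟩ := exists_isOpen_minLocus_eq (upperSemicontinuous_epsStarPt i) Λ
  obtain ⟨f, hfΛ, hfU⟩ : (Λ ∩ U).Nonempty := hΛU ▸ (isIrreducible_locus4 hΛ).nonempty
  have hne : (locus3 i Λ ∩ U).Nonempty := by
    rw [Set.inter_comm]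
    exact mem_closure_iff.1 ((closure_locus3 hΛ).ge hfΛ) U hU hfU
  have hinter : locus3 i Λ ∩ U ⊆ locus3 i Λ ∩ locus4 i Λ :=
    fun g ⟨hg, hgU⟩ => ⟨hg, hΛU.ge ⟨hg.1, hgU⟩⟩
  have hdense := (subset_closure_inter_of_isPreirreducible_of_isOpen
    (isIrreducible_locus3 hΛ).isPreirreducible hU hne).trans (closure_mono hinter)
  exact (closure_locus3 hΛ).ge.trans (closure_minimal hdense isClosed_closure)

theorem sInf_epsStarPt_closure_extensions {T : Set (EC k K b)} (hT : T.Nonempty) :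
    sInf (epsStarPt i '' closure (extensions (b + simpleDim i) T)) =
      sInf (epsStarPt i '' T) + 1 := by
  obtain ⟨f', hf', hmin⟩ := Nat.sInf_mem (hT.image (epsStarPt i))
  obtain ⟨f, hf⟩ := exists_extension (i := i) f'
  have hfT : f ∈ extensions (b + simpleDim i) T := ⟨f', hf', hf⟩
  rw [sInf_image_closure (upperSemicontinuous_epsStarPt i) ⟨f, hfT⟩, ← hmin, ← hf.epsStarPt_eq]
  refine IsLeast.csInf_eq ⟨⟨f, hfT, rfl⟩, ?_⟩
  rintro _ ⟨g, ⟨g', hg', hg⟩, rfl⟩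
  rw [hf.epsStarPt_eq, hg.epsStarPt_eq, hmin]
  exact Nat.succ_le_succ (Nat.sInf_le ⟨g', hg', rfl⟩)

theorem sInf_epsStarPt_closure_extensions_locus3 (hΛ : Λ ∈ irreducibleComponents (EC k K b)) :
    sInf (epsStarPt i '' closure (extensions (b + simpleDim i) (locus3 i Λ))) =
      sInf (epsStarPt i '' Λ) + 1 := by
  have hne := (isIrreducible_locus3 (i := i) hΛ).nonempty
  rw [sInf_epsStarPt_closure_extensions hne,
    ← sInf_image_closure (upperSemicontinuous_epsStarPt i) hne, closure_locus3 hΛ]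

variable [Infinite K]

theorem isPreirreducible_quotientPairs_locus4
    (hΛ' : Λ' ∈ irreducibleComponents (EC k K (b + simpleDim i))) :
    IsPreirreducible
      {p : EC k K (b + simpleDim i) × EC k K b | p.1 ∈ locus4 i Λ' ∧ HasQuotient p.1 p.2} :=
  isPreirreducible_quotientPairs (isIrreducible_locus4 hΛ').isPreirreducible
    fun _ hf _ hg => (mem_minLocus_iff.1 hf).2.trans (mem_minLocus_iff.1 hg).2.symm

theorem isPreirreducible_extensions_locus3 (hΛ : Λ ∈ irreducibleComponents (EC k K b)) :
    IsPreirreducible (extensions (b + simpleDim i) (locus3 i Λ)) := by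
  rw [extensions_eq_image_fst]
  exact (isPreirreducible_extensionPairs (isIrreducible_locus3 hΛ).isPreirreducible
    fun _ hf _ hg => (mem_minLocus_iff.1 hf).2.trans (mem_minLocus_iff.1 hg).2.symm).image
    _ continuous_fst.continuousOn

theorem isPreirreducible_quotients_locus4
    (hΛ' : Λ' ∈ irreducibleComponents (EC k K (b + simpleDim i))) :
    IsPreirreducible (quotients b (locus4 i Λ')) := by
  rw [quotients_eq_image_snd]
  exact (isPreirreducible_quotientPairs_locus4 hΛ').image _ continuous_snd.continuousOn

theorem closure_quotients_eq (hΛ : Λ ∈ irreducibleComponents (EC k K b))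
    (hΛ' : Λ' ∈ irreducibleComponents (EC k K (b + simpleDim i)))
    (h : closure (extensions (b + simpleDim i) (locus3 i Λ)) = Λ') :
    closure (quotients b (locus4 i Λ')) = Λ := by
  refine closure_eq_of_mem_irreducibleComponents hΛ (isPreirreducible_quotients_locus4 hΛ') ?_
  refine (subset_closure_locus3_inter_locus4 (i := i) hΛ).trans (closure_mono ?_)
  rintro f' ⟨h₃, h₄⟩
  obtain ⟨f, hf⟩ := exists_extension (i := i) f'
  have hfΛ' : f ∈ Λ' := h ▸ subset_closure ⟨f', h₃, hf⟩
  refine ⟨f, mem_minLocus_iff.2 ⟨hfΛ', ?_⟩, hf⟩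
  rw [hf.epsStarPt_eq, (mem_minLocus_iff.1 h₄).2, ← h,
    sInf_epsStarPt_closure_extensions_locus3 hΛ]

theorem closure_extensions_eq (hΛ : Λ ∈ irreducibleComponents (EC k K b))
    (hΛ' : Λ' ∈ irreducibleComponents (EC k K (b + simpleDim i)))
    (hpos : 0 < sInf (epsStarPt i '' Λ')) (h : closure (quotients b (locus4 i Λ')) = Λ) :
    closure (extensions (b + simpleDim i) (locus3 i Λ)) = Λ' := by
  refine closure_eq_of_mem_irreducibleComponents hΛ' (isPreirreducible_extensions_locus3 hΛ) ?_
  let R : Set (EC k K (b + simpleDim i) × EC k K b) :=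
    {p | p.1 ∈ locus4 i Λ' ∧ HasQuotient p.1 p.2}
  have hquot : quotients b (locus4 i Λ') ⊆ Λ := h ▸ subset_closure
  obtain ⟨U, hU, hΛU⟩ := exists_isOpen_minLocus_eq (upperSemicontinuous_finrank_extStar i) Λ
  have hlocus3 : Prod.fst '' (R ∩ Prod.snd ⁻¹' U) ⊆ extensions _ (locus3 i Λ) := by
    rintro _ ⟨p, ⟨hp, hpU⟩, rfl⟩
    exact ⟨p.2, hΛU.ge ⟨hquot ⟨p.1, hp⟩, hpU⟩, hp.2⟩
  have hne : (R ∩ Prod.snd ⁻¹' U).Nonempty := by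
    obtain ⟨f', hf'⟩ := (isIrreducible_locus3 (i := i) hΛ).nonempty
    obtain ⟨g', hg'U, g, hg⟩ := mem_closure_iff.1 (h.ge hf'.1) U hU (hΛU.le hf').2
    exact ⟨(g, g'), hg, hg'U⟩
  have hdense : R ⊆ closure (R ∩ Prod.snd ⁻¹' U) :=
    subset_closure_inter_of_isPreirreducible_of_isOpen (isPreirreducible_quotientPairs_locus4 hΛ')
      (hU.preimage continuous_snd) hne
  rw [← closure_locus4 (i := i) hΛ']
  refine closure_minimal (fun f hf => ?_) isClosed_closure
  obtain ⟨f', hf'⟩ : ∃ f' : EC k K b, HasQuotient f f' :=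
    exists_quotient (hpos.trans_eq (mem_minLocus_iff.1 hf).2.symm)
  have hfcl := image_closure_subset_closure_image continuous_fst
    (Set.mem_image_of_mem Prod.fst (hdense (show (f, f') ∈ R from ⟨hf, hf'⟩)))
  exact closure_mono hlocus3 hfcl

end Loci

end Operators

/-! ### The crystal structure -/

section CrystalAxioms

variable {d : ℕ} {m : Fin d → ℕ}

theorem isGCM_cartan (m : Fin d → ℕ) : IsGCM (cartan m) where
  diag i := if_pos rfl
  nonpos i j h := by
    rw [cartan, if_neg h]
    lia
  symm_ne_zero i j h := by
    rw [cartan, cartan, if_neg h, if_neg h.symm]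
    lia

variable {𝔥 : Type*} [AddCommGroup 𝔥] [Module ℂ 𝔥]

namespace WeightLattice

variable {I : Type*} [Fintype I] {A : Matrix I I ℤ} {R : Realization A 𝔥} (L : WeightLattice R)

theorem pairing_add (i : I) (v w : L.P) :
    L.pairing i (v + w) = L.pairing i v + L.pairing i w := by
  rw [← Int.cast_inj (α := ℂ), Int.cast_add, ← L.pairing_spec, ← L.pairing_spec, ← L.pairing_spec]
  rfl

theorem pairing_simpleRoot (i j : I) : L.pairing i (L.simpleRoot j) = A i j := by
  rw [← Int.cast_inj (α := ℂ), ← L.pairing_spec, simpleRoot, R.root_coroot]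

end WeightLattice

theorem eq_add_coe_neg_of_eq_add_coe {x y : WithBot ℤ} {n : ℤ} (h : y = x + n) :
    x = y + (-n : ℤ) := by
  rw [h, add_assoc, ← WithBot.coe_add, add_neg_cancel, WithBot.coe_zero, add_zero]

variable {k K : Type*} [Field k] [Field K] [Algebra k K]

section Components

variable {ν μ : Vertex m → ℕ} {i : Vertex m} {Λ : Set (EC k K μ)} {Λ' : Set (EC k K ν)}
  {hΛ : Λ ∈ irreducibleComponents (EC k K μ)} {hΛ' : Λ' ∈ irreducibleComponents (EC k K ν)}

theorem fStar_eq_some_iff (h : ν = μ + simpleDim i) :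
    fStar i (⟨μ, Λ, hΛ⟩ : BC k K m) = some ⟨ν, Λ', hΛ'⟩ ↔
      closure (extensions ν (locus3 i Λ)) = Λ' := by
  rw [← image_varpi4_preimage_varpi3 fun j => congrFun h j]
  subst h
  rw [fStar]
  constructor
  · intro h
    split_ifs at h
    simp only [Option.some.injEq, Sigma.mk.injEq, heq_eq_eq, Subtype.mk.injEq, true_and] at h
    exact h
  · rintro rfl
    exact dif_pos hΛ'

theorem eStar_eq_some_iff (h : ν = μ + simpleDim i) :
    eStar i (⟨ν, Λ', hΛ'⟩ : BC k K m) = some ⟨μ, Λ, hΛ⟩ ↔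
      0 < sInf (epsStarPt i '' Λ') ∧ closure (quotients μ (locus4 i Λ')) = Λ := by
  rw [← image_varpi3_preimage_varpi4 fun j => congrFun h j]
  obtain rfl : μ = ν - simpleDim i := h ▸ (add_tsub_cancel_right μ _).symm
  rw [eStar]
  constructor
  · intro h
    split_ifs at h with h₀
    simp only [Option.some.injEq, Sigma.mk.injEq, heq_eq_eq, Subtype.mk.injEq, true_and] at h
    exact ⟨h₀.1, h⟩
  · rintro ⟨h₀, rfl⟩
    exact dif_pos ⟨h₀, hΛ⟩

end Components

variable {i : Vertex m} {b b' : BC k K m}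

theorem fst_eq_of_fStar_eq_some (h : fStar i b = some b') : b'.1 = b.1 + simpleDim i := by
  rw [fStar] at h
  split_ifs at h
  rw [← Option.some.inj h]

theorem epsStarNat_le (i : Vertex m) (b : BC k K m) : epsStarNat i b ≤ b.1 i := by
  obtain ⟨f, hf⟩ := b.2.2.1.nonempty
  exact (Nat.sInf_le (Set.mem_image_of_mem _ hf)).trans
    ((Submodule.finrank_le _).trans_eq (Module.finrank_fin_fun K))

theorem fst_eq_of_eStar_eq_some (h : eStar i b' = some b) : b'.1 = b.1 + simpleDim i := by
  rw [eStar] at h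
  split_ifs at h with h₀
  rw [← Option.some.inj h]
  have hpos : 0 < b'.1 i := h₀.1.trans_le (epsStarNat_le i b')
  have hle : simpleDim i ≤ b'.1 := update_le_iff.2 ⟨hpos, fun _ _ => Nat.zero_le _⟩
  exact (tsub_add_cancel_of_le hle).symm

theorem eStar_eq_some_iff_fStar_eq_some [Infinite K] (i : Vertex m) (b b' : BC k K m) :
    eStar i b' = some b ↔ fStar i b = some b' := by
  suffices h : b'.1 = b.1 + simpleDim i → (eStar i b' = some b ↔ fStar i b = some b') from
    ⟨fun he => (h (fst_eq_of_eStar_eq_some he)).1 he,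
      fun hf => (h (fst_eq_of_fStar_eq_some hf)).2 hf⟩
  obtain ⟨μ, Λ, hΛ⟩ := b
  obtain ⟨ν, Λ', hΛ'⟩ := b'
  rintro rfl
  rw [eStar_eq_some_iff rfl, fStar_eq_some_iff rfl]
  refine ⟨fun ⟨hpos, h⟩ => closure_extensions_eq hΛ hΛ' hpos h,
    fun h => ⟨?_, closure_quotients_eq hΛ hΛ' h⟩⟩
  rw [← h, sInf_epsStarPt_closure_extensions_locus3 hΛ]
  exact Nat.succ_pos _

theorem epsStarNat_of_fStar_eq_some (h : fStar i b = some b') :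
    epsStarNat i b' = epsStarNat i b + 1 := by
  have hdim := fst_eq_of_fStar_eq_some h
  obtain ⟨μ, Λ, hΛ⟩ := b
  obtain ⟨ν, Λ', hΛ'⟩ := b'
  obtain rfl : ν = μ + simpleDim i := hdim
  obtain rfl := (fStar_eq_some_iff rfl).1 h
  exact sInf_epsStarPt_closure_extensions_locus3 hΛ

theorem epsStar_of_fStar_eq_some (h : fStar i b = some b') :
    epsStar i b' = epsStar i b + ((1 : ℤ) : WithBot ℤ) := by
  rw [epsStar, epsStarNat_of_fStar_eq_some h]
  rfl

variable {R : Realization (cartan m) 𝔥} (L : WeightLattice R)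

theorem weight_of_fStar_eq_some (h : fStar i b = some b') :
    weight L b' = weight L b - L.simpleRoot i := by
  simp only [weight, fst_eq_of_fStar_eq_some h, simpleDim, Pi.add_apply, Pi.single_apply,
    Nat.cast_add, Nat.cast_ite, Nat.cast_one, Nat.cast_zero, add_smul, ite_smul, one_smul,
    zero_smul, Finset.sum_add_distrib, Finset.sum_ite_eq', Finset.mem_univ, if_true]
  abel

theorem phiStar_of_fStar_eq_some (h : fStar i b = some b') :
    phiStar L i b' = phiStar L i b + ((-1 : ℤ) : WithBot ℤ) := by
  have hpairing : L.pairing i (weight L b) = L.pairing i (weight L b') + 2 := by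
    rw [← sub_add_cancel (weight L b) (L.simpleRoot i), ← weight_of_fStar_eq_some L h,
      L.pairing_add, L.pairing_simpleRoot, (isGCM_cartan m).diag]
  rw [phiStar, phiStar, epsStar_of_fStar_eq_some h, hpairing, epsStar, ← WithBot.coe_add,
    ← WithBot.coe_add, ← WithBot.coe_add, ← WithBot.coe_add]
  exact congrArg WithBot.some (by lia)

end CrystalAxioms

end PersistenceCrystal

end

/-- For every field `k`, every infinite extension field `K` of `k`, every `m ∈ ℕ^d` and every
weight lattice for the Cartan matrix of the grid, the irreducible components of the varieties of
persistence modules form a crystal with the star-operators. For `K = k` (an infinite field) the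
points are the tuples of linear maps over `k` itself; for `K` an algebraic closure of an arbitrary
field `k` the closed sets are those of the variety over `k`. -/
theorem theorem3p14 {k K : Type*} [Field k] [Field K] [Algebra k K] [Infinite K]
    {d : ℕ} (m : Fin d → ℕ) {𝔥 : Type*} [AddCommGroup 𝔥] [Module ℂ 𝔥]
    (R : PersistenceCrystal.Realization (PersistenceCrystal.cartan m) 𝔥)
    (L : PersistenceCrystal.WeightLattice R) :
    PersistenceCrystal.IsCrystal L (B := PersistenceCrystal.BC k K m)
      (PersistenceCrystal.weight L) PersistenceCrystal.epsStar (PersistenceCrystal.phiStar L)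
      PersistenceCrystal.eStar PersistenceCrystal.fStar := by
  open PersistenceCrystal in
  refine
    { isGCM := isGCM_cartan m
      phi_eq := fun _ _ => rfl
      e_apply := fun i b b' h => ?_
      f_apply := fun i b b' h => ⟨weight_of_fStar_eq_some L h, epsStar_of_fStar_eq_some h,
        phiStar_of_fStar_eq_some L h⟩
      e_iff_f := eStar_eq_some_iff_fStar_eq_some
      bot := fun i b h => absurd h WithBot.coe_ne_bot }
  have hf : fStar i b' = some b := (eStar_eq_some_iff_fStar_eq_some i b' b).1 h
  exact ⟨eq_add_of_sub_eq (weight_of_fStar_eq_some L hf).symm,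
    eq_add_coe_neg_of_eq_add_coe (epsStar_of_fStar_eq_some hf),
    eq_add_coe_neg_of_eq_add_coe (phiStar_of_fStar_eq_some L hf)⟩
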